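/- **Theorem 3 (pilot-assisted DT lower bound).** Consider the Rician block-fading channel with $\ell\ge 1$ coherence blocks of length $n_c$, Rician factor $\kappa\ge 0$ and SNR $\rho>0$, $$\mathbf Y_k=H_k\mathbf x_k+\mathbf W_k\in\mathbb C^{n_c},\qquad k=1,\dots,\ell,$$ where $H_k\sim\mathcal{CN}(\mu_H,\sigma_H^2)$, $\mu_H=\sqrt{\kappa/(1+\kappa)}$, $\sigma_H^2=(1+\kappa)^{-1}$, $\mathbf W_k\sim\mathcal{CN}(\mathbf 0,\mathbf I_{n_c})$, and all these variables are independent. An $(\ell,n_c,M,\epsilon,\rho)$-code consists of codewords $\mathbf c_m=[\mathbf c_{m,1},\dots,\mathbf c_{m,\ell}]$, $m=1,\dots,M$, with $\|\mathbf c_{m,k}\|^2=n_c\rho$ for all $m,k$, and a decoder that sees only $(\mathbf Y_1,\dots,\mathbf Y_\ell)$ and whose average error probability over equiprobable messages is at most $\epsilon$. For $0\le\epsilon<1$ let $$R^*=\sup\Big\{\tfrac{\log_2 M}{\ell n_c}:\ \text{there is an }(\ell,n_c,M,\epsilon,\rho)\text{-code}\Big\}.$$ Let $0\le n_p<n_c$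 be the number of pilot symbols per coherence block, $n_d=n_c-n_p$ and $\sigma_e^2=(n_p\rho)^{-1}$. Let the channel estimates $\widehat H_1,\dots,\widehat H_\ell$ be i.i.d. with the law that results from $\widehat H_k\sim\mathcal{CN}(h_k,\sigma_e^2)$ given $H_k=h_k$, and put $$\mu_p(\hat h)=\frac{\sigma_H^2\hat h+\sigma_e^2\mu_H}{\sigma_H^2+\sigma_e^2},\qquad \sigma_p^2=\frac{\sigma_H^2\sigma_e^2}{\sigma_H^2+\sigma_e^2}$$ (for $n_p=0$, where $\sigma_e^2=\infty$, these read $\mu_p=\mu_H$, $\sigma_p^2=\sigma_H^2$). Let $\mathbf w_1,\dots,\mathbf w_\ell\sim\mathcal{CN}(\mathbf 0,\mathbf I_{n_d})$ be i.i.d. and independent of the estimates, let $$\widetilde{\mathbf w}_k=\begin{bmatrix}\mu_p(\widehat H_k)\sqrt{n_d\rho}\\ \mathbf 0_{n_d-1}\end{bmatrix}+\begin{bmatrix}\sqrt{\sigma_p^2n_d\rho+1}\\ \mathbf 1_{n_d-1}\end{bmatrix}\odot\mathbf w_k,$$ where $\odot$ is the entrywise product, and $$\begin{aligned}\bar S_k(\widehat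 H_k)={}&\frac{|\mu_p(\widehat H_k)|^2}{\sigma_p^2}+\|\widetilde{\mathbf w}_k\|^2-\|\mathbf w_k\|^2-\log\frac{\Gamma(n_d)\,(\sigma_p^2n_d\rho+1)}{\sigma_p^2}\\&-\log\int_0^\infty\frac{e^{-(\rho n_d+\sigma_p^{-2})z}}{\big(\sqrt{\|\widetilde{\mathbf w}_k\|^2\rho n_dz}\big)^{n_d-1}}\,I_0\Big(2\sqrt{z|\mu_p(\widehat H_k)|^2/\sigma_p^4}\Big)\,I_{n_d-1}\Big(2\sqrt{\|\widetilde{\mathbf w}_k\|^2\rho n_dz}\Big)\,dz,\end{aligned}$$ where $I_\nu$ is the modified Bessel function of the first kind. For integers $M\ge1$ let $$\epsilon_{ub}^{(n_p)}(M)=\mathbb E\Big[\exp\Big\{-\Big[\sum_{k=1}^{\ell}\bar S_k(\widehat H_k)-\log\tfrac{M-1}{2}\Big]^+\Big\}\Big],$$ where the expectation is over the noise vectors and the channel estimates, $[a]^+=\max\{0,a\}$ and $\log 0=-\infty$ (so that $\epsilon_{ub}^{(n_p)}(1)=0$). Then the maximum on the right-hand side exists, and $$R^*\ \ge\ \max\Big\{\frac{\log_2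 M}{n_c\ell}:\ M\ge1,\ \epsilon_{ub}^{(n_p)}(M)\le\epsilon\Big\}.$$ -/

import Mathlib

open MeasureTheory ProbabilityTheory
open scoped ENNReal NNReal

noncomputable section

namespace RicianPilot

/-- The law `CN(μ, v)` of a circularly-symmetric complex Gaussian random variable with mean `μ` and
variance `v` (real and imaginary parts of the centred variable are independent `N(0, v/2)`). -/
def complexGaussian (μ : ℂ) (v : ℝ) : Measure ℂ :=
  ((gaussianReal 0 (v / 2).toNNReal).prod (gaussianReal 0 (v / 2).toNNReal)).map
    (fun p : ℝ × ℝ => μ + ((p.1 : ℂ) + (p.2 : ℂ) * Complex.I))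

/-- The law `CN(0, I_n)` of a complex Gaussian noise vector. -/
def noiseLaw (n : ℕ) : Measure (Fin n → ℂ) :=
  Measure.pi fun _ => complexGaussian 0 1

/-- The squared `ℓ²` norm of a complex vector. -/
def normSq {n : ℕ} (x : Fin n → ℂ) : ℝ := ∑ i, ‖x i‖ ^ 2

/-- Mean `√(κ / (1 + κ))` of the Rician fading coefficient. -/
def muH (κ : ℝ) : ℝ := Real.sqrt (κ / (1 + κ))

/-- Variance `(1 + κ)⁻¹` of the Rician fading coefficient. -/
def varH (κ : ℝ) : ℝ := (1 + κ)⁻¹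

/-- Law of the output `H x + W` of one coherence block with input `x`, where
`H ~ CN(μ_H, σ_H²)` and `W ~ CN(0, I)` are independent. -/
def blockLaw (κ : ℝ) {n : ℕ} (x : Fin n → ℂ) : Measure (Fin n → ℂ) :=
  ((complexGaussian (muH κ : ℂ) (varH κ)).prod (noiseLaw n)).map
    (fun p : ℂ × (Fin n → ℂ) => p.1 • x + p.2)

/-- Law of the channel output over `l` independent coherence blocks. -/
def channelLaw (κ : ℝ) {l n : ℕ} (x : Fin l → Fin n → ℂ) : Measure (Fin l → Fin n → ℂ) :=
  Measure.pi fun k => blockLaw κ (x k)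

/-- An `(l, nc, M, ε, ρ)`-code for the Rician block-fading channel with Rician factor `κ`. -/
structure Code (κ : ℝ) (l nc M : ℕ) (ε ρ : ℝ) where
  /-- the encoder -/
  enc : Fin M → Fin l → Fin nc → ℂ
  /-- the decoder -/
  dec : (Fin l → Fin nc → ℂ) → Fin M
  /-- the decoder is measurable -/
  measurable_dec : Measurable dec
  /-- power constraint on each subcodeword -/
  power : ∀ m k, normSq (enc m k) = nc * ρ
  /-- the average error probability is at most `ε` -/
  error_le : (1 / (M : ℝ)) * ∑ j, (channelLaw κ (enc j)).real {y | dec y ≠ j} ≤ ε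

/-- The maximum coding rate, in bits per channel use (a supremum in the extended reals). -/
def maxRate (κ : ℝ) (l nc : ℕ) (ε ρ : ℝ) : EReal :=
  sSup {r : EReal | ∃ M : ℕ, Nonempty (Code κ l nc M ε ρ) ∧
    r = ((Real.logb 2 M / ((l : ℝ) * nc) : ℝ) : EReal)}

/-- The modified Bessel function of the first kind `I_ν`, of order `ν ∈ ℕ`. -/
def besselI (ν : ℕ) (x : ℝ) : ℝ :=
  ∑' m : ℕ, (x / 2) ^ (2 * m + ν) / ((m.factorial : ℝ) * Real.Gamma ((m : ℝ) + ν + 1))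

/-- The vector `[μ √(n ρ), 0, …, 0] + [√(v n ρ + 1), 1, …, 1] ⊙ w`. -/
def wTilde {n : ℕ} (ρ : ℝ) (μ : ℂ) (v : ℝ) (w : Fin n → ℂ) : Fin n → ℂ := fun i =>
  if (i : ℕ) = 0 then
    μ * (Real.sqrt (n * ρ) : ℂ) + (Real.sqrt (v * n * ρ + 1) : ℂ) * w i
  else w i

/-- The integral that occurs in the output density induced by a shell code of length `n` and power
`n ρ` over a fading channel with fading law `CN(μ, v)`, at an output of squared norm `t`. -/
def shellIntegral (n : ℕ) (ρ : ℝ) (μ : ℂ) (v t : ℝ) : ℝ :=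
  ∫ z in Set.Ioi (0 : ℝ),
    Real.exp (-(ρ * n + v⁻¹) * z) / (Real.sqrt (t * ρ * n * z)) ^ (n - 1)
      * besselI 0 (2 * Real.sqrt (z * ‖μ‖ ^ 2 / v ^ 2))
      * besselI (n - 1) (2 * Real.sqrt (t * ρ * n * z))

/-- The information density `S` of one block of length `n`, as a function of the noise `w`, for the
fading law `CN(μ, v)` and shell codes of power `n ρ`. -/
def infoS {n : ℕ} (ρ : ℝ) (μ : ℂ) (v : ℝ) (w : Fin n → ℂ) : ℝ :=
  ‖μ‖ ^ 2 / v + normSq (wTilde ρ μ v w) - normSq w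
    - Real.log (Real.Gamma n * (v * n * ρ + 1) / v)
    - Real.log (shellIntegral n ρ μ v (normSq (wTilde ρ μ v w)))

/-- Variance `(np ρ)⁻¹` of the channel estimation error. -/
def varE (np : ℕ) (ρ : ℝ) : ℝ := ((np : ℝ) * ρ)⁻¹

/-- Law of the maximum-likelihood channel estimate: `CN(h, σ_e²)` given the fading coefficient `h`,
that is, the law of `H + E` for independent `H ~ CN(μ_H, σ_H²)` and `E ~ CN(0, σ_e²)`. -/
def estimateLaw (κ : ℝ) (np : ℕ) (ρ : ℝ) : Measure ℂ :=
  ((complexGaussian (muH κ : ℂ) (varH κ)).prod (complexGaussian 0 (varE np ρ))).map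
    (fun p : ℂ × ℂ => p.1 + p.2)

/-- Mean of the fading coefficient given the channel estimate `h`. Without pilots there is no
information on the fading coefficient (`σ_e² = ∞`), and the mean is `μ_H`. -/
def muP (κ : ℝ) (np : ℕ) (ρ : ℝ) (h : ℂ) : ℂ :=
  if np = 0 then (muH κ : ℂ)
  else ((varH κ : ℂ) * h + (varE np ρ : ℂ) * (muH κ : ℂ)) / ((varH κ + varE np ρ : ℝ) : ℂ)

/-- Variance of the fading coefficient given the channel estimate; it is `σ_H²` without pilots. -/
def varP (κ : ℝ) (np : ℕ) (ρ : ℝ) : ℝ :=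
  if np = 0 then varH κ else varH κ * varE np ρ / (varH κ + varE np ρ)

/-- `exp(-[s - log((M-1)/2)]⁺)`, computed in the extended reals: for `M = 1` the logarithm is `-∞`
and the value is `0`. -/
def dtTerm (M : ℕ) (s : ℝ) : ℝ≥0∞ :=
  EReal.exp (-(max 0 ((s : EReal) - ENNReal.log (ENNReal.ofReal (((M : ℝ) - 1) / 2)))))

/-- The error bound of pilot-assisted transmission: the expectation is over the independent pairs
(channel estimate, noise vector of length `nc - np`) of the `l` blocks, whose two entries are
independent. -/
def epsUB (κ : ℝ) (l nc np : ℕ) (ρ : ℝ) (M : ℕ) : ℝ≥0∞ :=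
  ∫⁻ ω : Fin l → ℂ × (Fin (nc - np) → ℂ),
    dtTerm M (∑ k, infoS ρ (muP κ np ρ (ω k).1) (varP κ np ρ) (ω k).2)
    ∂(Measure.pi fun _ => (estimateLaw κ np ρ).prod (noiseLaw (nc - np)))

end RicianPilot

end

noncomputable section

namespace RicianPilot

/-! The proof is random coding on spheres. In each block the energy `np * ρ` goes into a single
pilot symbol, and the last `nc - np` symbols carry a vector uniform on the sphere of squared radius
`(nc - np) * ρ`. The pilot output divided by its amplitude is `H + E` with law `estimateLaw`.
Completing the square (`cgaussPDF_mul_cgaussPDF`) shows that, given this estimate, the fading is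
complex Gaussian with mean `muP` and variance `varP`. The receiver thus sees a shell-code channel
with side information (`exists_observation`). Without pilots, a dummy estimate `0` plays this role.

Such a channel is handled by `exists_codebook`. The decoder picks the first message whose likelihood
ratio `p / q` exceeds `γ = (M - 1) / 2`, the mean number of earlier competitors. The miss
probability plus `γ` times the false-alarm probability is the integral of `p * min 1 (γ / (p / q))`,
and this minimum is `exp (-[log (p / q) - log γ]⁺)`, the form of `dtTerm`.

It remains to identify the law of `p / q`. The noise is isotropic, so a unitary map carries every
shell codeword to `[√(n ρ), 0, …, 0]`; hence the ratio has the same law for all codewords, namely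
its law at the output `wTilde` (`map_blockPDF_div`). Its denominator, the output density averaged
over the sphere, is computed in `lintegral_outPDF_shellPoint`: averaging an exponential over the
sphere of `ℂⁿ` gives the series of `I_{n-1}`, averaging over the phase of the fading gives that of
`I_0`, and the squared modulus of the fading is the remaining variable `z`. So the ratio is almost
surely `exp` of `infoS` (`axisPDF_div_mixPDF`), and the ratios of independent blocks multiply.

The maximum exists because `M = 1` is admissible and `epsUB` increases with `M` to `1 > ε`. -/

/-! ### Integrals and densities on product spaces -/

theorem lintegral_pi_prod {X : Type*} [MeasurableSpace X] {n : ℕ} (μ : Fin n → Measure X)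
    [∀ i, SigmaFinite (μ i)] (f : Fin n → X → ℝ≥0∞) (hf : ∀ i, Measurable (f i)) :
    ∫⁻ x, ∏ i, f i (x i) ∂(Measure.pi μ) = ∏ i, ∫⁻ x, f i x ∂(μ i) := by
  induction n with
  | zero => simp
  | succ n ih =>
    have h := (measurePreserving_piFinSuccAbove μ 0).symm
    rw [← h.lintegral_comp_emb (MeasurableEquiv.measurableEmbedding _), Fin.prod_univ_succ,
      ← ih (fun i => μ i.succ) (fun i => f i.succ) fun i => hf _]
    refine Eq.trans (lintegral_congr fun a => ?_) (lintegral_prod_mul (f := f 0)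
      (g := fun x : Fin n → X => ∏ i, f i.succ (x i)) (hf 0).aemeasurable
      (Finset.measurable_prod _ fun i _ => (hf _).comp (measurable_pi_apply i)).aemeasurable)
    rw [Fin.prod_univ_succ]
    rfl

theorem pi_withDensity {X : Type*} [MeasurableSpace X] {n : ℕ} (μ : Fin n → Measure X)
    [∀ i, SigmaFinite (μ i)] (f : Fin n → X → ℝ≥0∞) (hf : ∀ i, Measurable (f i))
    [∀ i, SigmaFinite ((μ i).withDensity (f i))] :
    Measure.pi (fun i => (μ i).withDensity (f i)) =
      (Measure.pi μ).withDensity (fun x => ∏ i, f i (x i)) := by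
  refine Measure.pi_eq fun s hs => ?_
  rw [withDensity_apply _ (MeasurableSet.univ_pi hs), Measure.restrict_pi_pi]
  rw [lintegral_pi_prod _ f hf]
  exact Finset.prod_congr rfl fun i _ => (withDensity_apply _ (hs i)).symm

/-- Distinct codewords of a random codebook are independent. The transmitted one, index `j`, is
integrated innermost, so that averaging over it can turn a conditional density into the output
density. -/
theorem lintegral_pi_eval₂ {X ι : Type*} [MeasurableSpace X] [Fintype ι] (P : Measure X)
    [IsProbabilityMeasure P] {j k : ι} (hjk : j ≠ k) (g : X → X → ℝ≥0∞)
    (hg : Measurable (Function.uncurry g)) :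
    ∫⁻ c : ι → X, g (c j) (c k) ∂(Measure.pi fun _ => P) = ∫⁻ x', ∫⁻ x, g x x' ∂P ∂P := by
  have hind : iIndepFun (fun (i : ι) (ω : ι → X) => ω i) (Measure.pi fun _ : ι => P) :=
    iIndepFun_pi (X := fun (_ : ι) (x : X) => x) fun _ => aemeasurable_id
  have h := (indepFun_iff_map_prod_eq_prod_map_map (measurable_pi_apply j).aemeasurable
    (measurable_pi_apply k).aemeasurable).1 (hind.indepFun hjk)
  have e : ∀ i, (Measure.pi fun _ : ι => P).map (fun ω : ι → X => ω i) = P := fun i =>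
    (measurePreserving_eval (fun _ : ι => P) i).map_eq
  rw [e, e] at h
  calc ∫⁻ c : ι → X, g (c j) (c k) ∂(Measure.pi fun _ => P)
      = ∫⁻ z, Function.uncurry g z ∂(P.prod P) := by
        rw [← h, lintegral_map hg (by fun_prop)]; rfl
    _ = ∫⁻ x', ∫⁻ x, g x x' ∂P ∂P := lintegral_prod_symm _ hg.aemeasurable

/-! ### The dependence-testing bound -/

/-- The sequential threshold decoder: the least index whose flag is set. -/
def firstIndex {M : ℕ} (hM : 0 < M) (s : Fin M → Prop) : Fin M :=
  open Classical in if h : ∃ i, s i then Fin.find s h else ⟨0, hM⟩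

/-- A decoding error is either a miss or a false alarm at an earlier index; later indices do no
harm. -/
theorem of_firstIndex_ne {M : ℕ} (hM : 0 < M) (s : Fin M → Prop) (j : Fin M)
    (h : firstIndex hM s ≠ j) : ¬ s j ∨ ∃ k < j, s k := by
  classical
  by_contra! hc
  apply h
  unfold firstIndex
  rw [dif_pos ⟨j, hc.1⟩]
  refine le_antisymm ?_ ?_
  · convert Fin.find_le_of_pos _ hc.1
  · by_contra! hlt
    refine hc.2 _ hlt ?_
    convert Fin.find_spec _

/-- Message `j` has `j` earlier competitors, so their mean number is `(M - 1) / 2`. This is the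
source of the threshold. -/
theorem sum_fin_val (M : ℕ) (hM : 0 < M) :
    ∑ j : Fin M, ((j : ℕ) : ℝ≥0∞) = M * ENNReal.ofReal (((M : ℝ) - 1) / 2) := by
  rw [Fin.sum_univ_eq_sum_range (fun i => (i : ℝ≥0∞)) M, ← Nat.cast_sum]
  have h1 : (1 : ℝ) ≤ M := by exact_mod_cast hM
  rw [← ENNReal.ofReal_natCast M, ← ENNReal.ofReal_mul (by positivity), ← ENNReal.ofReal_natCast]
  congr 1
  have := Finset.sum_range_id_mul_two M
  have h2 : ((∑ i ∈ Finset.range M, i : ℕ) : ℝ) * 2 = M * (M - 1) := by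
    rw [← Nat.cast_pred hM]; exact_mod_cast this
  linarith

/-- Thresholding the ratio at the weight `γ` itself makes the weighted error density `p` or `γ * q`,
whichever is smaller. -/
theorem threshold_add_eq {p q γ : ℝ≥0∞} (hp : p ≠ ⊤) (hq : q ≠ 0) (hq' : q ≠ ⊤) :
    p * (if γ < p / q then 0 else 1) + γ * (q * (if γ < p / q then 1 else 0)) =
      p * min 1 (γ / (p / q)) := by
  split_ifs with h
  · have hp0 : p ≠ 0 := by rintro rfl; simp at h
    have hpq : p / q ≠ ⊤ := ENNReal.div_ne_top hp hq
    have hpq0 : p / q ≠ 0 := (lt_of_le_of_lt zero_le h).ne'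
    rw [min_eq_right (ENNReal.div_le_of_le_mul (by simpa using h.le)), mul_zero, zero_add, mul_one,
      ENNReal.div_eq_inv_mul (a := γ), ENNReal.inv_div (Or.inl hq') (Or.inl hq), ← mul_assoc,
      ENNReal.mul_div_cancel hp0 hp, mul_comm]
  · rcases eq_or_ne p 0 with rfl | hp0
    · simp
    · have hpq : p / q ≠ ⊤ := ENNReal.div_ne_top hp hq
      have hpq0 : p / q ≠ 0 := ENNReal.div_ne_zero.2 ⟨hp0, hq'⟩
      rw [min_eq_left ((ENNReal.le_div_iff_mul_le (Or.inl hpq0) (Or.inl hpq)).2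
        (by simpa using not_lt.1 h))]
      simp

/-- The dependence-testing bound: random coding over `P` with a sequential threshold decoder. -/
theorem exists_codebook {X Y : Type*} [MeasurableSpace X] [MeasurableSpace Y] (P : Measure X)
    [IsProbabilityMeasure P] (ν : Measure Y) [SigmaFinite ν] (p : X → Y → ℝ≥0∞)
    (hp : Measurable (Function.uncurry p)) (hpt : ∀ x y, p x y ≠ ⊤) (q : Y → ℝ≥0∞)
    (hq : ∀ y, ∫⁻ x, p x y ∂P = q y) (hq0 : ∀ y, q y ≠ 0) (hqt : ∀ y, q y ≠ ⊤)
    {M : ℕ} (hM : 0 < M) :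
    ∃ (c : Fin M → X) (dec : Y → Fin M), Measurable dec ∧
      ∑ j, (ν.withDensity (p (c j))) {y | dec y ≠ j} ≤
        M * ∫⁻ x, ∫⁻ y, p x y *
          min 1 (ENNReal.ofReal (((M : ℝ) - 1) / 2) / (p x y / q y)) ∂ν ∂P := by
  set γ : ℝ≥0∞ := ENNReal.ofReal (((M : ℝ) - 1) / 2) with hγ
  have hγt : γ ≠ ⊤ := ENNReal.ofReal_ne_top
  have hqm : Measurable q := by
    have : q = fun y => ∫⁻ x, p x y ∂P := funext fun y => (hq y).symm
    rw [this]
    exact Measurable.lintegral_prod_left hp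
  have hpm : ∀ x, Measurable (p x) := fun x => hp.comp measurable_prodMk_left
  have hset : MeasurableSet {z : X × Y | γ < p z.1 z.2 / q z.2} :=
    measurableSet_lt measurable_const (hp.div (hqm.comp measurable_snd))
  let A : X → Y → ℝ≥0∞ := fun x y => if γ < p x y / q y then 1 else 0
  let B : X → Y → ℝ≥0∞ := fun x y => if γ < p x y / q y then 0 else 1
  have hA : Measurable (Function.uncurry A) :=
    Measurable.ite hset measurable_const measurable_const
  have hB : Measurable (Function.uncurry B) :=
    Measurable.ite hset measurable_const measurable_const
  have hAm : ∀ x, Measurable (A x) := fun x => hA.comp measurable_prodMk_left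
  have hpm' : ∀ y, Measurable fun x => p x y := fun y => hp.comp measurable_prodMk_right
  have hBm : ∀ x, Measurable (B x) := fun x => hB.comp measurable_prodMk_left
  have hpA : ∀ x x', Measurable fun y => p x y * A x' y := fun x x' => (hpm x).mul (hAm x')
  have hpB : ∀ x, Measurable fun y => p x y * B x y := fun x => (hpm x).mul (hBm x)
  let miss : X → ℝ≥0∞ := fun x => ∫⁻ y, p x y * B x y ∂ν
  let false_alarm : X → X → ℝ≥0∞ := fun x x' => ∫⁻ y, p x y * A x' y ∂ν
  have hmiss : Measurable miss := Measurable.lintegral_prod_right (hp.mul hB)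
  have hfa : Measurable (Function.uncurry false_alarm) := by
    have : Measurable fun z : (X × X) × Y => p z.1.1 z.2 * A z.1.2 z.2 :=
      (hp.comp ((measurable_fst.comp measurable_fst).prodMk measurable_snd)).mul
        (hA.comp ((measurable_snd.comp measurable_fst).prodMk measurable_snd))
    exact Measurable.lintegral_prod_right this
  let G : (Fin M → X) → ℝ≥0∞ := fun c =>
    ∑ j, (miss (c j) + ∑ k ∈ Finset.univ.filter (· < j), false_alarm (c j) (c k))
  have hfac : ∀ j k : Fin M, Measurable fun c : Fin M → X => false_alarm (c j) (c k) := fun j k =>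
    hfa.comp (f := fun c : Fin M → X => (c j, c k))
      ((measurable_pi_apply j).prodMk (measurable_pi_apply k))
  have hmj : ∀ j : Fin M, Measurable fun c : Fin M → X => miss (c j) := fun j =>
    hmiss.comp (measurable_pi_apply j)
  have hGj : ∀ j : Fin M, Measurable fun c : Fin M → X =>
      miss (c j) + ∑ k ∈ Finset.univ.filter (· < j), false_alarm (c j) (c k) := fun j =>
    (hmj j).add (Finset.measurable_sum _ fun k _ => hfac j k)
  have hG : Measurable G := Finset.measurable_sum _ fun j _ => hGj j
  -- Some codebook is at least as good as the random one on average. The bound is on the sum over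
  -- messages, so a single codebook suffices.
  obtain ⟨c, hc⟩ := exists_le_lintegral (μ := Measure.pi fun _ : Fin M => P) hG.aemeasurable
  have hGint : ∫⁻ c, G c ∂(Measure.pi fun _ : Fin M => P) =
      M * ∫⁻ x, ∫⁻ y, p x y * min 1 (γ / (p x y / q y)) ∂ν ∂P := by
    have hfa2 : ∫⁻ x', ∫⁻ x, false_alarm x x' ∂P ∂P = ∫⁻ x', ∫⁻ y, q y * A x' y ∂ν ∂P := by
      refine lintegral_congr fun x' => ?_
      rw [lintegral_lintegral_swap
        (hp.mul ((hAm x').comp measurable_snd)).aemeasurable]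
      refine lintegral_congr fun y => ?_
      rw [lintegral_mul_const _ (hpm' y), hq]
    have h1 : ∀ j : Fin M, ∫⁻ c : Fin M → X, (miss (c j) +
        ∑ k ∈ Finset.univ.filter (· < j), false_alarm (c j) (c k))
          ∂(Measure.pi fun _ : Fin M => P) =
        (∫⁻ x, miss x ∂P) + (j : ℕ) * ∫⁻ x', ∫⁻ y, q y * A x' y ∂ν ∂P := by
      intro j
      rw [lintegral_add_left (hmj j),
        lintegral_finsetSum _ fun k _ => hfac j k]
      congr 1
      · exact (measurePreserving_eval (fun _ : Fin M => P) j).lintegral_comp hmiss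
      · rw [Finset.sum_congr rfl fun k hk => (lintegral_pi_eval₂ P
          (Finset.mem_filter.1 hk).2.ne' false_alarm hfa).trans hfa2]
        rw [Finset.sum_const, nsmul_eq_mul]
        congr 2
        have : Finset.univ.filter (· < j) = Finset.Iio j := by ext; simp
        rw [this, Fin.card_Iio]
    rw [lintegral_finsetSum _ fun j _ => hGj j, Finset.sum_congr rfl fun j _ => h1 j,
      Finset.sum_add_distrib, ← Finset.sum_mul, sum_fin_val M hM, Finset.sum_const,
      Finset.card_univ, Fintype.card_fin, nsmul_eq_mul, mul_assoc, ← mul_add, ← hγ]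
    congr 1
    rw [← lintegral_const_mul' _ _ hγt, ← lintegral_add_left hmiss]
    refine lintegral_congr fun x => ?_
    rw [← lintegral_const_mul' _ _ hγt, ← lintegral_add_left (hpB x)]
    exact lintegral_congr fun y => threshold_add_eq (hpt x y) (hq0 y) (hqt y)
  refine ⟨c, fun y => firstIndex hM fun m => γ < p (c m) y / q y, ?_, ?_⟩
  · refine (measurable_of_finite (firstIndex hM)).comp (measurable_pi_lambda _ fun m => ?_)
    exact measurableSet_setOfPred.1 (measurableSet_lt measurable_const ((hpm _).div hqm))
  · refine le_trans ?_ (hc.trans hGint.le)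
    refine Finset.sum_le_sum fun j _ => ?_
    -- Union bound: on the error event at least one of the indicators equals 1. Markov's inequality
    -- at level 1 then bounds its measure.
    have hsub : {y | firstIndex hM (fun m => γ < p (c m) y / q y) ≠ j} ⊆
        {y | 1 ≤ B (c j) y + ∑ k ∈ Finset.univ.filter (· < j), A (c k) y} := by
      intro y hy
      change 1 ≤ B (c j) y + ∑ k ∈ Finset.univ.filter (· < j), A (c k) y
      rcases of_firstIndex_ne hM _ j hy with h | ⟨k, hk, h⟩
      · exact le_trans (if_neg h).ge le_self_add
      · refine le_trans ?_ le_add_self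
        refine le_trans ?_ (Finset.single_le_sum (f := fun k => A (c k) y) (fun _ _ => zero_le)
          (Finset.mem_filter.2 ⟨Finset.mem_univ k, hk⟩))
        exact (if_pos h).ge
    have hsm : Measurable fun y =>
        B (c j) y + ∑ k ∈ Finset.univ.filter (· < j), A (c k) y :=
      (hBm _).add (Finset.measurable_sum _ fun k _ => hAm _)
    refine (measure_mono hsub).trans ?_
    have := mul_meas_ge_le_lintegral (μ := ν.withDensity (p (c j))) hsm 1
    rw [one_mul] at this
    refine this.trans (le_of_eq ?_)
    rw [lintegral_withDensity_eq_lintegral_mul _ (hpm _) hsm]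
    simp only [Pi.mul_apply, mul_add, Finset.mul_sum]
    rw [lintegral_add_left (hpB _), lintegral_finsetSum _ fun k _ => hpA _ _]

/-! ### Complex Gaussian densities -/

/-- The density of `CN(0, v)`. -/
def cgaussPDF (v : ℝ) (z : ℂ) : ℝ≥0∞ :=
  ENNReal.ofReal ((Real.pi * v)⁻¹ * Real.exp (-(‖z‖ ^ 2 / v)))

@[fun_prop]
theorem measurable_cgaussPDF (v : ℝ) : Measurable (cgaussPDF v) := by
  unfold cgaussPDF; fun_prop

theorem cgaussPDF_ne_top (v : ℝ) (z : ℂ) : cgaussPDF v z ≠ ⊤ := ENNReal.ofReal_ne_top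

theorem cgaussPDF_ne_zero {v : ℝ} (hv : 0 < v) (z : ℂ) : cgaussPDF v z ≠ 0 := by
  have := Real.pi_pos
  exact (ENNReal.ofReal_pos.2 (by positivity)).ne'

instance (μ : ℂ) (v : ℝ) : IsProbabilityMeasure (complexGaussian μ v) :=
  Measure.isProbabilityMeasure_map (by fun_prop)

instance (n : ℕ) : IsProbabilityMeasure (noiseLaw n) := by
  unfold noiseLaw; infer_instance

theorem complexGaussian_eq_withDensity (μ : ℂ) {v : ℝ} (hv : 0 < v) :
    complexGaussian μ v = volume.withDensity (fun z => cgaussPDF v (z - μ)) := by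
  have hv2 : (v / 2).toNNReal ≠ 0 := by simpa using hv
  have hcv : ((v / 2).toNNReal : ℝ) = v / 2 := Real.coe_toNNReal _ (by positivity)
  refine Measure.ext_of_lintegral _ fun f hf => ?_
  rw [lintegral_withDensity_eq_lintegral_mul _ (by fun_prop) hf, complexGaussian,
    lintegral_map hf (by fun_prop), gaussianReal_of_var_ne_zero _ hv2,
    prod_withDensity (measurable_gaussianPDF _ _) (measurable_gaussianPDF _ _),
    lintegral_withDensity_eq_lintegral_mul _ (by fun_prop) (by fun_prop),
    ← lintegral_add_left_eq_self _ μ,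
    ← (Complex.volume_preserving_equiv_real_prod.symm).lintegral_comp_emb
      (MeasurableEquiv.measurableEmbedding _)]
  refine lintegral_congr fun p => ?_
  have e : Complex.measurableEquivRealProd.symm p = (p.1 : ℂ) + (p.2 : ℂ) * Complex.I := by
    apply Complex.ext <;> simp [Complex.measurableEquivRealProd_symm_apply]
  simp only [Pi.mul_apply, e, add_sub_cancel_left]
  congr 1
  rw [gaussianPDF, gaussianPDF, ← ENNReal.ofReal_mul (gaussianPDFReal_nonneg _ _ _), cgaussPDF]
  congr 1
  rw [gaussianPDFReal, gaussianPDFReal, hcv, mul_mul_mul_comm, ← Real.exp_add, ← mul_inv,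
    Real.mul_self_sqrt (by positivity), ← Complex.normSq_eq_norm_sq, Complex.normSq_add_mul_I]
  congr 2
  · ring
  · field_simp; ring

theorem lintegral_cgaussPDF_sub {v : ℝ} (hv : 0 < v) (μ : ℂ) :
    ∫⁻ z, cgaussPDF v (z - μ) = 1 := by
  have h := measure_univ (μ := complexGaussian μ v)
  rwa [complexGaussian_eq_withDensity μ hv, withDensity_apply _ .univ, Measure.restrict_univ] at h

theorem complexGaussian_zero_map (a : ℂ) (c v : ℝ) (hv : 0 ≤ v) :
    (complexGaussian 0 v).map (fun z => a + (c : ℂ) * z) = complexGaussian a (c ^ 2 * v) := by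
  have hg : gaussianReal 0 (c ^ 2 * v / 2).toNNReal =
      (gaussianReal 0 (v / 2).toNNReal).map (fun x => c * x) := by
    rw [gaussianReal_map_const_mul, mul_zero]
    congr 1
    ext
    simp only [NNReal.coe_mul, NNReal.coe_mk]
    rw [Real.coe_toNNReal _ (by positivity), Real.coe_toNNReal _ (by positivity)]
    ring
  rw [complexGaussian, complexGaussian, hg, Measure.map_prod_map _ _ (by fun_prop) (by fun_prop),
    Measure.map_map (by fun_prop) (by fun_prop), Measure.map_map (by fun_prop) (by fun_prop)]
  congr 1
  funext p
  simp only [Function.comp_apply, Prod.map, zero_add, Complex.ofReal_mul]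
  ring

/-- Completing the square: joint density of a Gaussian and a noisy observation of it, as marginal
times posterior. -/
theorem cgaussPDF_mul_cgaussPDF {v u : ℝ} (hv : 0 < v) (hu : 0 < u) (s : ℝ) (m h y : ℂ) :
    cgaussPDF v (h - m) * cgaussPDF u (y - h * s) =
      cgaussPDF (v * s ^ 2 + u) (y - m * s) *
        cgaussPDF (v * u / (v * s ^ 2 + u))
          (h - ((v * s : ℝ) * y + (u : ℝ) * m) / ((v * s ^ 2 + u : ℝ) : ℂ)) := by
  have hpi := Real.pi_pos
  have hτ : 0 < v * s ^ 2 + u := by positivity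
  have hd : h - ((v * s : ℝ) * y + (u : ℝ) * m) / ((v * s ^ 2 + u : ℝ) : ℂ) =
      (((v * s ^ 2 + u : ℝ) : ℂ) * h - ((v * s : ℝ) * y + (u : ℝ) * m)) *
        (((v * s ^ 2 + u)⁻¹ : ℝ) : ℂ) := by
    have : ((v * s ^ 2 + u : ℝ) : ℂ) ≠ 0 := by exact_mod_cast hτ.ne'
    rw [Complex.ofReal_inv]
    field_simp
  rw [hd]
  simp only [cgaussPDF]
  rw [← ENNReal.ofReal_mul (by positivity), ← ENNReal.ofReal_mul (by positivity),
    mul_mul_mul_comm, mul_mul_mul_comm (Real.pi * (v * s ^ 2 + u))⁻¹, ← Real.exp_add,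
    ← Real.exp_add, norm_mul]
  congr 2
  · field_simp
  · congr 1
    rw [mul_pow]
    simp only [← Complex.normSq_eq_norm_sq, Complex.normSq_apply, Complex.sub_re, Complex.sub_im,
      Complex.add_re, Complex.add_im, Complex.mul_re, Complex.mul_im, Complex.ofReal_re,
      Complex.ofReal_im]
    field_simp
    ring

/-- After completing the square only the posterior factor depends on `h`, and it integrates to 1. -/
theorem lintegral_cgaussPDF_mul {v u : ℝ} (hv : 0 < v) (hu : 0 < u) (s : ℝ) (m y : ℂ) :
    ∫⁻ h, cgaussPDF v (h - m) * cgaussPDF u (y - h * s) =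
      cgaussPDF (v * s ^ 2 + u) (y - m * s) := by
  simp_rw [cgaussPDF_mul_cgaussPDF hv hu]
  rw [lintegral_const_mul _ (by fun_prop), lintegral_cgaussPDF_sub (by positivity), mul_one]

theorem noiseLaw_eq_withDensity (n : ℕ) :
    noiseLaw n = volume.withDensity (fun w => ∏ i, cgaussPDF 1 (w i)) := by
  have e : complexGaussian 0 1 = volume.withDensity (cgaussPDF 1) := by
    simpa using complexGaussian_eq_withDensity 0 one_pos
  have : SigmaFinite ((volume : Measure ℂ).withDensity (cgaussPDF 1)) := e ▸ inferInstance
  rw [noiseLaw, e]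
  exact pi_withDensity _ _ fun _ => measurable_cgaussPDF 1

theorem prod_cgaussPDF_one {n : ℕ} (w : Fin n → ℂ) :
    ∏ i, cgaussPDF 1 (w i) =
      ENNReal.ofReal ((Real.pi ^ n)⁻¹ * Real.exp (-normSq w)) := by
  have hpi := Real.pi_pos
  simp only [cgaussPDF]
  rw [← ENNReal.ofReal_prod_of_nonneg fun i _ => by positivity, Finset.prod_mul_distrib,
    ← Real.exp_sum]
  congr 2
  · simp
  · simp [normSq]

/-! ### Polar coordinates and spherical averages -/

theorem lintegral_eq_lintegral_toSphere {E : Type*} [NormedAddCommGroup E] [NormedSpace ℝ E]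
    [FiniteDimensional ℝ E] [Nontrivial E] [MeasurableSpace E] [BorelSpace E] (μ : Measure E)
    [μ.IsAddHaarMeasure] (f : E → ℝ≥0∞) (hf : Measurable f) :
    ∫⁻ x, f x ∂μ = ∫⁻ u : Metric.sphere (0 : E) 1, (∫⁻ r in Set.Ioi (0 : ℝ),
      ENNReal.ofReal (r ^ (Module.finrank ℝ E - 1)) * f (r • (u : E))) ∂μ.toSphere := by
  have h0 : ∫⁻ x, f x ∂μ = ∫⁻ x : ({(0)}ᶜ : Set E), f x.1 ∂(μ.comap (↑)) := by
    rw [lintegral_subtype_comap (measurableSet_singleton _).compl f, restrict_compl_singleton]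
  have h1 := μ.measurePreserving_homeomorphUnitSphereProd.symm
    (homeomorphUnitSphereProd E).toMeasurableEquiv
  rw [h0, ← h1.lintegral_comp_emb (MeasurableEquiv.measurableEmbedding _)]
  have hm : Measurable fun p : Metric.sphere (0 : E) 1 × Set.Ioi (0 : ℝ) =>
      f ((p.2 : ℝ) • (p.1 : E)) := by fun_prop
  refine Eq.trans (lintegral_congr fun p => ?_)
    ((lintegral_prod _ hm.aemeasurable).trans (lintegral_congr fun u => ?_))
  · rfl
  · rw [Measure.volumeIoiPow, lintegral_withDensity_eq_lintegral_mul _ (by fun_prop) (by fun_prop),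
      ← lintegral_subtype_comap measurableSet_Ioi
        fun r : ℝ => ENNReal.ofReal (r ^ (Module.finrank ℝ E - 1)) * f (r • (u : E))]
    rfl

theorem lintegral_Ioi_pow_mul_exp_neg_sq (k : ℕ) :
    ∫⁻ r in Set.Ioi (0 : ℝ), ENNReal.ofReal (r ^ k * Real.exp (-r ^ 2)) =
      ENNReal.ofReal (Real.Gamma (((k : ℝ) + 1) / 2) / 2) := by
  have h := integral_rpow_mul_exp_neg_rpow (p := 2) (q := k) two_pos
    (by have : (0 : ℝ) ≤ k := Nat.cast_nonneg k; linarith)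
  have e : ∀ r : ℝ, r ^ (k : ℝ) * Real.exp (-r ^ (2 : ℝ)) = r ^ k * Real.exp (-r ^ 2) := by
    intro r; rw [Real.rpow_natCast, Real.rpow_two]
  simp_rw [e] at h
  rw [← ofReal_integral_eq_lintegral_ofReal, h]
  · congr 1; ring
  -- A non-integrable function would have Bochner integral `0` by convention, but the value is a
  -- positive Gamma value.
  · by_contra hn
    rw [integral_undef hn] at h
    have : 0 < Real.Gamma (((k : ℝ) + 1) / 2) := Real.Gamma_pos_of_pos (by positivity)
    linarith
  · filter_upwards [ae_restrict_mem measurableSet_Ioi] with r hr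
    have : (0 : ℝ) < r := hr
    positivity

theorem lintegral_pow_two_mul_exp_neg_sq (j : ℕ) :
    ∫⁻ r : ℝ, ENNReal.ofReal (r ^ (2 * j) * Real.exp (-r ^ 2)) =
      ENNReal.ofReal (Real.Gamma ((j : ℝ) + 1 / 2)) := by
  have hm : Measurable fun r : ℝ => ENNReal.ofReal (r ^ (2 * j) * Real.exp (-r ^ 2)) := by
    fun_prop
  have hneg : ∫⁻ r in Set.Iio (0 : ℝ), ENNReal.ofReal (r ^ (2 * j) * Real.exp (-r ^ 2)) =
      ∫⁻ r in Set.Ioi (0 : ℝ), ENNReal.ofReal (r ^ (2 * j) * Real.exp (-r ^ 2)) := by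
    have h := (Measure.measurePreserving_neg (volume : Measure ℝ)).setLIntegral_comp_preimage
      (s := Set.Ioi 0) measurableSet_Ioi hm
    simpa [pow_mul] using h
  rw [← lintegral_add_compl _ (measurableSet_Ioi (a := (0 : ℝ))), Set.compl_Ioi,
    setLIntegral_congr Iio_ae_eq_Iic.symm, hneg, lintegral_Ioi_pow_mul_exp_neg_sq,
    ← ENNReal.ofReal_add (by positivity) (by positivity)]
  congr 1
  push_cast
  rw [add_halves]
  congr 1
  ring

section

variable {E : Type*} [NormedAddCommGroup E] [InnerProductSpace ℝ E] [FiniteDimensional ℝ E]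
  [MeasurableSpace E] [BorelSpace E]

/-- In an orthonormal basis whose first vector points along `a`, the Gaussian weight splits into
one-dimensional factors and the power involves only the first coordinate. -/
theorem lintegral_inner_pow_mul_exp_neg_sq {N : ℕ} (hN : Module.finrank ℝ E = N + 1) (a : E)
    (j : ℕ) :
    ∫⁻ x : E, ENNReal.ofReal (inner ℝ a x ^ (2 * j) * Real.exp (-‖x‖ ^ 2)) =
      ENNReal.ofReal (‖a‖ ^ (2 * j) * Real.Gamma ((j : ℝ) + 1 / 2) * Real.sqrt Real.pi ^ N) := by
  obtain ⟨e, he, hae⟩ : ∃ e : E, ‖e‖ = 1 ∧ a = ‖a‖ • e := by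
    rcases eq_or_ne a 0 with rfl | ha
    -- For `a = 0` any unit vector serves as direction.
    · have : Nontrivial E := Module.nontrivial_of_finrank_pos (R := ℝ) (by omega)
      obtain ⟨e, he⟩ := exists_norm_eq E zero_le_one
      exact ⟨e, he, by simp⟩
    · refine ⟨‖a‖⁻¹ • a, ?_, ?_⟩
      · rw [norm_smul, norm_inv, norm_norm, inv_mul_cancel₀ (norm_ne_zero_iff.2 ha)]
      · rw [smul_smul, mul_inv_cancel₀ (norm_ne_zero_iff.2 ha), one_smul]
  have horth : Orthonormal ℝ (({0} : Set (Fin (N + 1))).domRestrict fun _ => e) := by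
    rw [orthonormal_iff_ite]
    rintro ⟨i, rfl⟩ ⟨k, rfl⟩
    simp [Set.domRestrict, he]
  obtain ⟨b, hb⟩ := horth.exists_orthonormalBasis_extension_of_card_eq
    (by rw [hN, Fintype.card_fin])
  have hb0 : b 0 = e := hb 0 rfl
  have hmp : MeasurePreserving (fun x : E => (WithLp.ofLp (b.repr x) : Fin (N + 1) → ℝ)) :=
    (PiLp.volume_preserving_ofLp _).comp b.measurePreserving_repr
  let g : Fin (N + 1) → ℝ → ℝ≥0∞ := fun i r =>
    if i = 0 then ENNReal.ofReal (‖a‖ ^ (2 * j)) * ENNReal.ofReal (r ^ (2 * j) * Real.exp (-r ^ 2))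
    else ENNReal.ofReal (r ^ (2 * 0) * Real.exp (-r ^ 2))
  have hg : ∀ i, Measurable (g i) := fun i => by
    by_cases h : i = 0
    · simp only [g, h, if_true]; fun_prop
    · simp only [g, h, if_false]; fun_prop
  have hpt : ∀ x : E, ENNReal.ofReal (inner ℝ a x ^ (2 * j) * Real.exp (-‖x‖ ^ 2)) =
      ∏ i, g i (b.repr x i) := by
    intro x
    have hin : inner ℝ a x = ‖a‖ * b.repr x 0 := by
      conv_lhs => rw [hae, inner_smul_left, ← hb0, ← b.repr_apply_apply]
      simp
    have hn : ‖x‖ ^ 2 = ∑ i, b.repr x i ^ 2 := by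
      rw [← b.repr.norm_map x, EuclideanSpace.norm_sq_eq]; simp
    rw [hin, hn, Fin.prod_univ_succ, Fin.sum_univ_succ]
    simp only [g, if_true, Fin.succ_ne_zero, if_false]
    simp only [mul_zero, pow_zero, one_mul]
    rw [← ENNReal.ofReal_prod_of_nonneg fun _ _ => Real.exp_nonneg _,
      ← ENNReal.ofReal_mul (by positivity),
      ← ENNReal.ofReal_mul (by rw [pow_mul (b.repr x 0)]; positivity)]
    congr 1
    rw [← Real.exp_sum]
    rw [mul_pow, neg_add, Real.exp_add, Finset.sum_neg_distrib]
    ring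
  have hprodm : Measurable fun y : Fin (N + 1) → ℝ => ∏ i, g i (y i) :=
    Finset.measurable_prod _ fun i _ => (hg i).comp (measurable_pi_apply i)
  have := hmp.lintegral_comp hprodm
  simp only [hpt]
  rw [this, volume_pi, lintegral_pi_prod _ g hg, Fin.prod_univ_succ]
  simp only [g, if_true, Fin.succ_ne_zero, if_false]
  rw [lintegral_const_mul _ (by fun_prop), lintegral_pow_two_mul_exp_neg_sq,
    lintegral_pow_two_mul_exp_neg_sq, Finset.prod_const, Finset.card_univ, Fintype.card_fin,
    ← ENNReal.ofReal_pow (by positivity), ← ENNReal.ofReal_mul (by positivity),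
    ← ENNReal.ofReal_mul (by positivity)]
  rw [Nat.cast_zero, zero_add, Real.Gamma_one_half_eq]

/-- The series `∑ s ^ j / (j! Γ(j + n))`. -/
def sphereSeries (n : ℕ) (s : ℝ) : ℝ≥0∞ :=
  ∑' j : ℕ, ENNReal.ofReal (s ^ j / ((j.factorial : ℝ) * Real.Gamma ((j : ℝ) + n)))

@[fun_prop]
theorem measurable_sphereSeries (n : ℕ) : Measurable (sphereSeries n) := by
  unfold sphereSeries
  exact Measurable.tsum fun j => by fun_prop

/-- The Gaussian moment computed again in polar coordinates. Its radial part is `Γ(j + n) / 2`, so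
comparison with the Cartesian value yields the spherical moment, and for `j = 0` the area of the
sphere. -/
theorem lintegral_toSphere_inner_pow {n : ℕ} (hn : 0 < n)
    (hE : Module.finrank ℝ E = 2 * n) (a : E) (j : ℕ) :
    (∫⁻ u : Metric.sphere (0 : E) 1, ENNReal.ofReal (inner ℝ a (u : E) ^ (2 * j))
      ∂(volume : Measure E).toSphere) * ENNReal.ofReal (Real.Gamma ((j : ℝ) + n) / 2) =
      ENNReal.ofReal (‖a‖ ^ (2 * j) * Real.Gamma ((j : ℝ) + 1 / 2) *
        Real.sqrt Real.pi ^ (2 * n - 1)) := by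
  have : Nontrivial E := Module.nontrivial_of_finrank_pos (R := ℝ) (by omega)
  rw [← lintegral_inner_pow_mul_exp_neg_sq (E := E) (N := 2 * n - 1) (by omega),
    lintegral_eq_lintegral_toSphere (volume : Measure E) _ (by fun_prop),
      ← lintegral_mul_const _ (by fun_prop)]
  refine lintegral_congr fun u => ?_
  have hu : ‖(u : E)‖ = 1 := by simp
  have h := lintegral_Ioi_pow_mul_exp_neg_sq (2 * n - 1 + 2 * j)
  have e : ((2 * n - 1 + 2 * j : ℕ) + 1 : ℝ) / 2 = (j : ℝ) + n := by
    have : ((2 * n - 1 + 2 * j : ℕ) + 1 : ℝ) = ((2 * n - 1 + 2 * j + 1 : ℕ) : ℝ) := by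
      push_cast; rfl
    rw [this, show 2 * n - 1 + 2 * j + 1 = 2 * n + 2 * j by omega]
    push_cast; ring
  rw [e] at h
  rw [← h, ← lintegral_const_mul _ (by fun_prop)]
  refine setLIntegral_congr_fun measurableSet_Ioi fun r hr => ?_
  have hr : (0 : ℝ) < r := hr
  rw [hE, ← ENNReal.ofReal_mul (by rw [pow_mul]; positivity), ← ENNReal.ofReal_mul (by positivity),
    inner_smul_right, norm_smul, hu, mul_one, Real.norm_eq_abs, sq_abs]
  congr 1
  ring

theorem toSphere_univ_mul {n : ℕ} (hn : 0 < n)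
    (hE : Module.finrank ℝ E = 2 * n)  :
    (volume : Measure E).toSphere Set.univ * ENNReal.ofReal (Real.Gamma n / 2) =
      ENNReal.ofReal (Real.pi ^ n) := by
  have h := lintegral_toSphere_inner_pow (E := E) hn hE 0 0
  simp only [mul_zero, pow_zero, ENNReal.ofReal_one, lintegral_one, one_mul, Nat.cast_zero,
    zero_add, Real.Gamma_one_half_eq] at h
  rw [h]
  congr 1
  rw [← pow_succ', show 2 * n - 1 + 1 = 2 * n by omega, pow_mul, Real.sq_sqrt Real.pi_pos.le]

/-- Antipodal symmetry, inherited from Lebesgue measure: the integrand extended to be constant along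
rays, with a Gaussian weight, integrates to the spherical integral times a positive finite constant.
-/
theorem lintegral_toSphere_exp_inner_neg {n : ℕ} (hn : 0 < n)
    (hE : Module.finrank ℝ E = 2 * n) (a : E) :
    ∫⁻ u : Metric.sphere (0 : E) 1, ENNReal.ofReal (Real.exp (-inner ℝ a (u : E)))
      ∂(volume : Measure E).toSphere =
    ∫⁻ u : Metric.sphere (0 : E) 1, ENNReal.ofReal (Real.exp (inner ℝ a (u : E)))
      ∂(volume : Measure E).toSphere := by
  have : Nontrivial E := Module.nontrivial_of_finrank_pos (R := ℝ) (by omega)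
  have key : ∀ a : E, ∫⁻ x : E, ENNReal.ofReal (Real.exp (inner ℝ a (‖x‖⁻¹ • x))) *
      ENNReal.ofReal (Real.exp (-‖x‖ ^ 2)) =
      (∫⁻ u : Metric.sphere (0 : E) 1, ENNReal.ofReal (Real.exp (inner ℝ a (u : E)))
      ∂(volume : Measure E).toSphere) * ENNReal.ofReal (Real.Gamma n / 2) := by
    intro a
    rw [lintegral_eq_lintegral_toSphere (volume : Measure E) _ (by fun_prop),
      ← lintegral_mul_const _ (by fun_prop)]
    refine lintegral_congr fun u => ?_
    have hu : ‖(u : E)‖ = 1 := by simp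
    have h := lintegral_Ioi_pow_mul_exp_neg_sq (2 * n - 1)
    have e : ((2 * n - 1 : ℕ) + 1 : ℝ) / 2 = n := by
      have : ((2 * n - 1 : ℕ) + 1 : ℝ) = ((2 * n - 1 + 1 : ℕ) : ℝ) := by push_cast; rfl
      rw [this, show 2 * n - 1 + 1 = 2 * n by omega]
      push_cast; ring
    rw [e] at h
    rw [← h, ← lintegral_const_mul _ (by fun_prop)]
    refine setLIntegral_congr_fun measurableSet_Ioi fun r hr => ?_
    have hr : (0 : ℝ) < r := hr
    rw [hE, norm_smul, hu, mul_one, Real.norm_eq_abs, abs_of_pos hr, smul_smul,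
      inv_mul_cancel₀ hr.ne', one_smul, ENNReal.ofReal_mul (by positivity)]
    ring
  have hneg : ∫⁻ x : E, ENNReal.ofReal (Real.exp (inner ℝ (-a) (‖x‖⁻¹ • x))) *
      ENNReal.ofReal (Real.exp (-‖x‖ ^ 2)) = ∫⁻ x : E,
      ENNReal.ofReal (Real.exp (inner ℝ a (‖x‖⁻¹ • x))) *
      ENNReal.ofReal (Real.exp (-‖x‖ ^ 2)) := by
    rw [← lintegral_neg_eq_self]
    simp
  rw [key, key] at hneg
  have hG : 0 < Real.Gamma n := Real.Gamma_pos_of_pos (by exact_mod_cast hn)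
  have := (ENNReal.mul_left_inj (ENNReal.ofReal_pos.2 (by positivity)).ne'
    ENNReal.ofReal_ne_top).1 hneg
  simpa using this

/-- Legendre duplication at half-integers; it turns the coefficients of `cosh` into those of the
Bessel series. -/
theorem two_pow_div_factorial_mul_Gamma (j : ℕ) :
    (2 : ℝ) ^ (2 * j) / ((2 * j).factorial : ℝ) * Real.Gamma ((j : ℝ) + 1 / 2) =
      Real.sqrt Real.pi / (j.factorial : ℝ) := by
  induction j with
  | zero => simpa using Real.Gamma_one_half_eq
  | succ j ih =>
    have h : Real.Gamma (((j + 1 : ℕ) : ℝ) + 1 / 2) =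
        ((j : ℝ) + 1 / 2) * Real.Gamma ((j : ℝ) + 1 / 2) := by
      rw [← Real.Gamma_add_one (by positivity)]; congr 1; push_cast; ring
    rw [h, Nat.factorial_succ j, show (2 * (j + 1)).factorial = (2 * j + 1 + 1).factorial from rfl,
      Nat.factorial_succ,
      Nat.factorial_succ, show 2 * (j + 1) = 2 * j + 1 + 1 from rfl, pow_succ, pow_succ]
    push_cast
    have h2 : Real.sqrt Real.pi / (((j : ℝ) + 1) * (j.factorial : ℝ)) =
        Real.sqrt Real.pi / (j.factorial : ℝ) / ((j : ℝ) + 1) := by field_simp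
    rw [h2, ← ih]
    field_simp
    ring

/-- The spherical average of an exponential. -/
theorem lintegral_toSphere_exp_inner {n : ℕ} (hn : 0 < n)
    (hE : Module.finrank ℝ E = 2 * n) (a : E) :
    ∫⁻ u : Metric.sphere (0 : E) 1, ENNReal.ofReal (Real.exp (2 * inner ℝ a (u : E)))
      ∂(volume : Measure E).toSphere =
    (volume : Measure E).toSphere Set.univ *
      (ENNReal.ofReal (Real.Gamma n) * sphereSeries n (‖a‖ ^ 2)) := by
  set σ := (volume : Measure E).toSphere with hσ
  have hG : ∀ j : ℕ, 0 < Real.Gamma ((j : ℝ) + n) := fun j => Real.Gamma_pos_of_pos (by positivity)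
  have hGn : 0 < Real.Gamma n := by simpa using hG 0
  have hpi := Real.pi_pos
  have e2 : ∀ u : E, 2 * inner ℝ a u = inner ℝ ((2 : ℝ) • a) u := fun u => by
    rw [inner_smul_left]; simp
  -- Pairing `u` with `-u` removes the odd powers. The surviving terms are nonnegative, so sum and
  -- integral may be exchanged without a convergence argument.
  have hcosh : ∀ t : ℝ, ENNReal.ofReal (Real.exp t) + ENNReal.ofReal (Real.exp (-t)) =
      2 * ∑' j : ℕ, ENNReal.ofReal (t ^ (2 * j) / ((2 * j).factorial : ℝ)) := by
    intro t
    have h := Real.hasSum_cosh t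
    rw [← ENNReal.ofReal_tsum_of_nonneg (fun j => by rw [pow_mul]; positivity) h.summable,
      h.tsum_eq, ← ENNReal.ofReal_add (by positivity) (by positivity), ← ENNReal.ofReal_ofNat 2,
      ← ENNReal.ofReal_mul (by norm_num), Real.cosh_eq]
    congr 1
    ring
  have hterm : ∀ j : ℕ, ∫⁻ u : Metric.sphere (0 : E) 1,
      ENNReal.ofReal (inner ℝ ((2 : ℝ) • a) (u : E) ^ (2 * j) / ((2 * j).factorial : ℝ)) ∂σ =
      (σ Set.univ * ENNReal.ofReal (Real.Gamma n)) *
        ENNReal.ofReal ((‖a‖ ^ 2) ^ j / ((j.factorial : ℝ) * Real.Gamma ((j : ℝ) + n))) := by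
    intro j
    have h1 := lintegral_toSphere_inner_pow hn hE ((2 : ℝ) • a) j
    have h2 := toSphere_univ_mul (E := E) hn hE
    rw [← hσ] at h1 h2
    have h3 : σ Set.univ * ENNReal.ofReal (Real.Gamma n) = ENNReal.ofReal (2 * Real.pi ^ n) := by
      rw [ENNReal.ofReal_mul zero_le_two, ← h2, mul_left_comm, ← ENNReal.ofReal_mul zero_le_two]
      congr 2
      ring
    rw [h3, ← ENNReal.ofReal_mul (by positivity)]
    simp_rw [div_eq_mul_inv (_ ^ (2 * j)) ((2 * j).factorial : ℝ)]
    have hm : Measurable fun u : Metric.sphere (0 : E) 1 =>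
        ENNReal.ofReal (inner ℝ ((2 : ℝ) • a) (u : E) ^ (2 * j)) := by fun_prop
    simp_rw [ENNReal.ofReal_mul' (p := inner ℝ ((2 : ℝ) • a) _ ^ (2 * j))
      (inv_nonneg.2 (Nat.cast_nonneg (2 * j).factorial))]
    rw [lintegral_mul_const _ hm]
    have hG2 : 0 < Real.Gamma ((j : ℝ) + n) / 2 := half_pos (hG j)
    refine (ENNReal.mul_left_inj (ENNReal.ofReal_pos.2 hG2).ne' ENNReal.ofReal_ne_top).1 ?_
    rw [mul_right_comm, h1, ← ENNReal.ofReal_mul' (by positivity), ← ENNReal.ofReal_mul' hG2.le]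
    congr 1
    have h4 := two_pow_div_factorial_mul_Gamma j
    have h5 : Real.sqrt Real.pi ^ (2 * n - 1) * Real.sqrt Real.pi = Real.pi ^ n := by
      rw [← pow_succ, show 2 * n - 1 + 1 = 2 * n by omega, pow_mul, Real.sq_sqrt hpi.le]
    rw [norm_smul, mul_pow, Real.norm_ofNat]
    calc _ = ‖a‖ ^ (2 * j) *
          (2 ^ (2 * j) / ((2 * j).factorial : ℝ) * Real.Gamma ((j : ℝ) + 1 / 2)) *
          Real.sqrt Real.pi ^ (2 * n - 1) := by ring
      _ = ‖a‖ ^ (2 * j) / (j.factorial : ℝ) * Real.pi ^ n := by rw [h4, ← h5]; ring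
      _ = _ := by
        rw [pow_mul]
        have := (hG j).ne'
        field_simp
  have hdouble : 2 * ∫⁻ u : Metric.sphere (0 : E) 1,
      ENNReal.ofReal (Real.exp (2 * inner ℝ a (u : E))) ∂σ =
      2 * (σ Set.univ * (ENNReal.ofReal (Real.Gamma n) * sphereSeries n (‖a‖ ^ 2))) := by
    simp only [e2]
    have h := lintegral_toSphere_exp_inner_neg hn hE ((2 : ℝ) • a)
    rw [← hσ] at h
    conv_lhs => rw [two_mul]
    nth_rewrite 2 [← h]
    rw [← lintegral_add_left (by fun_prop)]
    simp_rw [hcosh]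
    rw [lintegral_const_mul _ (Measurable.tsum fun j => by fun_prop),
      lintegral_tsum fun j => by fun_prop]
    simp_rw [hterm]
    rw [ENNReal.tsum_mul_left, sphereSeries, mul_assoc]
  exact (ENNReal.mul_right_inj two_ne_zero ENNReal.ofNat_ne_top).1 hdouble

end

/-! ### Bessel functions and the shell integral -/

/-- The terms agree because `(√s) ^ (2 * m) = s ^ m`. The half-integer power `√s ^ ν` is what the
denominator in `shellIntegral` cancels. -/
theorem besselI_two_mul_sqrt (ν : ℕ) {s : ℝ} (hs : 0 ≤ s) :
    besselI ν (2 * Real.sqrt s) = Real.sqrt s ^ ν * (sphereSeries (ν + 1) s).toReal := by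
  rw [besselI, sphereSeries, ENNReal.tsum_toReal_eq fun _ => ENNReal.ofReal_ne_top, ← tsum_mul_left]
  refine tsum_congr fun m => ?_
  have hG : 0 < Real.Gamma ((m : ℝ) + (ν + 1 : ℕ)) := Real.Gamma_pos_of_pos (by positivity)
  rw [ENNReal.toReal_ofReal (by positivity), mul_div_cancel_left₀ _ two_ne_zero, pow_add, pow_mul,
    Real.sq_sqrt hs]
  push_cast
  rw [← add_assoc]
  ring

/-- Averaging a tilted radial function on `ℂ`. -/
theorem lintegral_complex_radial_mul_exp (f : ℝ → ℝ≥0∞) (hf : Measurable f) (a : ℂ) :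
    ∫⁻ h : ℂ, f (‖h‖ ^ 2) * ENNReal.ofReal (Real.exp (2 * inner ℝ a h)) =
      ∫⁻ z in Set.Ioi (0 : ℝ), ENNReal.ofReal Real.pi * (f z * sphereSeries 1 (z * ‖a‖ ^ 2)) := by
  have hE : Module.finrank ℝ ℂ = 2 * 1 := Complex.finrank_real_complex
  set σ := (volume : Measure ℂ).toSphere with hσ
  have hσ1 : σ Set.univ = ENNReal.ofReal (2 * Real.pi) := by
    have h := toSphere_univ_mul (E := ℂ) one_pos hE
    have h2 : ENNReal.ofReal (Real.Gamma ((1 : ℕ) : ℝ) / 2) = 2⁻¹ := by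
      rw [Nat.cast_one, Real.Gamma_one, one_div, ENNReal.ofReal_inv_of_pos two_pos,
        ENNReal.ofReal_ofNat]
    rw [h2, pow_one, ← hσ, ← div_eq_mul_inv] at h
    rw [ENNReal.ofReal_mul zero_le_two, ← h, ENNReal.ofReal_ofNat,
      ENNReal.mul_div_cancel two_ne_zero ENNReal.ofNat_ne_top]
  -- Substitution `z = r²`: its Jacobian `2 * r` absorbs the polar weight `r`, and half the
  -- circumference `2π` remains as the factor `π`.
  have himage : (fun r : ℝ => r ^ 2) '' Set.Ioi 0 = Set.Ioi 0 := by
    ext z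
    constructor
    · rintro ⟨r, hr, rfl⟩
      exact pow_pos (show (0 : ℝ) < r from hr) 2
    · intro hz
      exact ⟨Real.sqrt z, Real.sqrt_pos.2 hz, Real.sq_sqrt (le_of_lt hz)⟩
  rw [lintegral_eq_lintegral_toSphere (volume : Measure ℂ) _ (by fun_prop), ← hσ,
    lintegral_lintegral_swap (Measurable.aemeasurable (by fun_prop))]
  conv_rhs => rw [← himage]
  rw [lintegral_image_eq_lintegral_abs_deriv_mul measurableSet_Ioi
    (f' := fun r => 2 * r) (fun r _ => by simpa using (hasDerivAt_pow 2 r).hasDerivWithinAt)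
    (fun x hx y hy h => (pow_left_inj₀ (le_of_lt hx) (le_of_lt hy) two_ne_zero).1 h)]
  refine setLIntegral_congr_fun measurableSet_Ioi fun r hr => ?_
  have hr : (0 : ℝ) < r := hr
  have hu : ∀ u : Metric.sphere (0 : ℂ) 1, ‖r • (u : ℂ)‖ ^ 2 = r ^ 2 := fun u => by
    rw [norm_smul, norm_eq_of_mem_sphere, mul_one, Real.norm_eq_abs, sq_abs]
  have hin : ∀ u : ℂ, inner ℝ a (r • u) = inner ℝ (r • a) u := fun u => by
    rw [inner_smul_left, inner_smul_right]; rfl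
  simp only [hu, hin]
  rw [lintegral_const_mul _ (by fun_prop), lintegral_const_mul _ (by fun_prop),
    lintegral_toSphere_exp_inner one_pos hE, ← hσ, hσ1, hE, Nat.cast_one, Real.Gamma_one,
    ENNReal.ofReal_one, one_mul, norm_smul, mul_pow, Real.norm_eq_abs, sq_abs, abs_of_pos
    (by positivity), ENNReal.ofReal_mul zero_le_two, ENNReal.ofReal_mul zero_le_two, pow_one]
  ring

/-- The integral `shellIntegral` as an integral of power series. -/
def shellLIntegral (n : ℕ) (ρ : ℝ) (μ : ℂ) (v t : ℝ) : ℝ≥0∞ :=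
  ∫⁻ z in Set.Ioi (0 : ℝ), ENNReal.ofReal (Real.exp (-(ρ * n + v⁻¹) * z)) *
    sphereSeries 1 (z * ‖μ‖ ^ 2 / v ^ 2) * sphereSeries n (t * ρ * n * z)

/-- For positive `t` and `z` the power in the denominator cancels against the prefactor of
`I_{n-1}`. Finiteness rules out that the Bochner integral takes its default value. -/
theorem shellIntegral_eq_toReal {n : ℕ} (hn : 0 < n) {ρ t v : ℝ} (hρ : 0 < ρ) (ht : 0 < t) (μ : ℂ)
    (h : shellLIntegral n ρ μ v t ≠ ⊤) :
    shellIntegral n ρ μ v t = (shellLIntegral n ρ μ v t).toReal := by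
  have hm : Measurable fun z : ℝ => ENNReal.ofReal (Real.exp (-(ρ * n + v⁻¹) * z)) *
      sphereSeries 1 (z * ‖μ‖ ^ 2 / v ^ 2) * sphereSeries n (t * ρ * n * z) := by fun_prop
  rw [shellLIntegral, ← integral_toReal hm.aemeasurable (ae_lt_top hm h), shellIntegral]
  refine setIntegral_congr_fun measurableSet_Ioi fun z hz => ?_
  have hz : (0 : ℝ) < z := hz
  have hn' : (0 : ℝ) < n := by exact_mod_cast hn
  have hs : 0 < t * ρ * n * z := by positivity
  have hs' : Real.sqrt (t * ρ * n * z) ^ (n - 1) ≠ 0 := (pow_pos (Real.sqrt_pos.2 hs) _).ne'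
  rw [besselI_two_mul_sqrt _ hs.le, besselI_two_mul_sqrt _ (by positivity), Nat.sub_add_cancel hn,
    ENNReal.toReal_mul, ENNReal.toReal_mul, ENNReal.toReal_ofReal (Real.exp_nonneg _), pow_zero,
    one_mul]
  field_simp

/-! ### The output density of a random shell codeword -/

/-- The uniform distribution on the unit sphere of `ℂⁿ`. -/
def shellLaw (n : ℕ) : Measure (Metric.sphere (0 : EuclideanSpace ℂ (Fin n)) 1) :=
  ((volume : Measure (EuclideanSpace ℂ (Fin n))).toSphere Set.univ)⁻¹ •
    (volume : Measure (EuclideanSpace ℂ (Fin n))).toSphere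

/-- The shell codeword of power `n ρ` in the direction of a unit vector. -/
def shellPoint {n : ℕ} (ρ : ℝ) (u : Metric.sphere (0 : EuclideanSpace ℂ (Fin n)) 1) : Fin n → ℂ :=
  fun i => (Real.sqrt (n * ρ) : ℂ) * (u : EuclideanSpace ℂ (Fin n)) i

theorem finrank_real_euclideanSpace (n : ℕ) :
    Module.finrank ℝ (EuclideanSpace ℂ (Fin n)) = 2 * n := by
  rw [← Module.finrank_mul_finrank ℝ ℂ, Complex.finrank_real_complex, finrank_euclideanSpace_fin]

theorem toSphere_univ_ne {n : ℕ} (hn : 0 < n) :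
    (volume : Measure (EuclideanSpace ℂ (Fin n))).toSphere Set.univ ≠ 0 ∧
    (volume : Measure (EuclideanSpace ℂ (Fin n))).toSphere Set.univ ≠ ⊤ := by
  refine ⟨fun h => ?_, measure_ne_top _ _⟩
  have h2 := toSphere_univ_mul (E := EuclideanSpace ℂ (Fin n)) hn (finrank_real_euclideanSpace n)
  have := Real.pi_pos
  rw [h, zero_mul, eq_comm, ENNReal.ofReal_eq_zero] at h2
  exact absurd h2 (not_le.2 (by positivity))

theorem isProbabilityMeasure_shellLaw {n : ℕ} (hn : 0 < n) :
    IsProbabilityMeasure (shellLaw n) :=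
  ⟨by rw [shellLaw, Measure.smul_apply, smul_eq_mul,
    ENNReal.inv_mul_cancel (toSphere_univ_ne hn).1 (toSphere_univ_ne hn).2]⟩

theorem lintegral_shellLaw_exp_inner {n : ℕ} (hn : 0 < n) (a : EuclideanSpace ℂ (Fin n)) :
    ∫⁻ u, ENNReal.ofReal (Real.exp (2 * inner ℝ a (u : EuclideanSpace ℂ (Fin n)))) ∂(shellLaw n) =
      ENNReal.ofReal (Real.Gamma n) * sphereSeries n (‖a‖ ^ 2) := by
  rw [shellLaw, lintegral_smul_measure,
    lintegral_toSphere_exp_inner hn (finrank_real_euclideanSpace n), smul_eq_mul, ← mul_assoc,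
    ENNReal.inv_mul_cancel (toSphere_univ_ne hn).1 (toSphere_univ_ne hn).2, one_mul]

theorem normSq_eq_norm_sq {n : ℕ} (x : Fin n → ℂ) :
    normSq x = ‖(WithLp.toLp 2 x : EuclideanSpace ℂ (Fin n))‖ ^ 2 := by
  rw [EuclideanSpace.norm_sq_eq, normSq]

theorem shellPoint_eq {n : ℕ} (ρ : ℝ) (u : Metric.sphere (0 : EuclideanSpace ℂ (Fin n)) 1) :
    (WithLp.toLp 2 (shellPoint ρ u) : EuclideanSpace ℂ (Fin n)) =
      (Real.sqrt (n * ρ) : ℂ) • (u : EuclideanSpace ℂ (Fin n)) := by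
  ext i; simp [shellPoint]

theorem normSq_shellPoint {n : ℕ} {ρ : ℝ} (hρ : 0 ≤ ρ)
    (u : Metric.sphere (0 : EuclideanSpace ℂ (Fin n)) 1) : normSq (shellPoint ρ u) = n * ρ := by
  rw [normSq_eq_norm_sq, shellPoint_eq, norm_smul, norm_eq_of_mem_sphere, mul_one,
    Complex.norm_real, Real.norm_eq_abs, sq_abs, Real.sq_sqrt (by positivity)]

/-- Density of the output `h x + W` of a block of fading law `CN(m, v)`. -/
def outPDF {n : ℕ} (v : ℝ) (m : ℂ) (x y : Fin n → ℂ) : ℝ≥0∞ :=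
  ∫⁻ h, cgaussPDF v (h - m) * ∏ i, cgaussPDF 1 (y i - h * x i)

/-- The fading is moved by conjugation to the side of `y`, so that `u` enters only through an inner
product with a fixed vector, as the spherical average requires. -/
theorem normSq_sub_shellPoint {n : ℕ} {ρ : ℝ} (hρ : 0 ≤ ρ) (y : Fin n → ℂ) (h : ℂ)
    (u : Metric.sphere (0 : EuclideanSpace ℂ (Fin n)) 1) :
    normSq (fun i => y i - h * shellPoint ρ u i) = normSq y + n * ρ * ‖h‖ ^ 2 -
      2 * inner ℝ ((starRingEnd ℂ (h * Real.sqrt (n * ρ))) •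
        (WithLp.toLp 2 y : EuclideanSpace ℂ (Fin n))) (u : EuclideanSpace ℂ (Fin n)) := by
  have e : (WithLp.toLp 2 (fun i => y i - h * shellPoint ρ u i) : EuclideanSpace ℂ (Fin n)) =
      WithLp.toLp 2 y - (h * Real.sqrt (n * ρ)) • (u : EuclideanSpace ℂ (Fin n)) := by
    ext i; simp [shellPoint, mul_assoc]
  rw [normSq_eq_norm_sq, e, norm_sub_sq_real, ← normSq_eq_norm_sq]
  have h1 : ‖(h * Real.sqrt (n * ρ)) • (u : EuclideanSpace ℂ (Fin n))‖ ^ 2 = n * ρ * ‖h‖ ^ 2 := by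
    rw [norm_smul, norm_eq_of_mem_sphere, mul_one, norm_mul,
      Complex.norm_real, Real.norm_eq_abs, mul_pow, sq_abs, Real.sq_sqrt (by positivity), mul_comm]
  have h2 : inner ℝ (WithLp.toLp 2 y) ((h * Real.sqrt (n * ρ)) • (u : EuclideanSpace ℂ (Fin n))) =
      inner ℝ ((starRingEnd ℂ (h * Real.sqrt (n * ρ))) •
        (WithLp.toLp 2 y : EuclideanSpace ℂ (Fin n))) (u : EuclideanSpace ℂ (Fin n)) := by
    have hre : ∀ a b : EuclideanSpace ℂ (Fin n), inner ℝ a b = (inner ℂ a b).re := by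
      intro a b
      rw [PiLp.inner_apply, PiLp.inner_apply, Complex.re_sum]
      exact Finset.sum_congr rfl fun i _ => rfl
    rw [hre, hre, inner_smul_left, inner_smul_right, Complex.conj_conj]
  rw [h1, h2]
  ring

/-- The output density induced by the uniform distribution on the shell. -/
theorem lintegral_outPDF_shellPoint {n : ℕ} (hn : 0 < n) {ρ v : ℝ} (hρ : 0 < ρ) (hv : 0 < v)
    (m : ℂ) (y : Fin n → ℂ) :
    ∫⁻ u, outPDF v m (shellPoint ρ u) y ∂(shellLaw n) =
      ENNReal.ofReal ((Real.pi ^ n)⁻¹ * Real.exp (-normSq y) * (Real.Gamma n / v) *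
        Real.exp (-(‖m‖ ^ 2 / v))) * shellLIntegral n ρ m v (normSq y) := by
  have := isProbabilityMeasure_shellLaw hn
  have hpi := Real.pi_pos
  have hG : 0 < Real.Gamma n := Real.Gamma_pos_of_pos (by exact_mod_cast hn)
  have hmeas : Measurable fun p : Metric.sphere (0 : EuclideanSpace ℂ (Fin n)) 1 × ℂ =>
      cgaussPDF v (p.2 - m) * ∏ i, cgaussPDF 1 (y i - p.2 * shellPoint ρ p.1 i) := by
    refine Measurable.mul (by fun_prop) (Finset.measurable_prod _ fun i _ => ?_)
    unfold shellPoint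
    fun_prop
  simp only [outPDF]
  rw [lintegral_lintegral_swap hmeas.aemeasurable]
  -- For fixed fading the sphere is averaged out and leaves a function of `‖h‖²`. The phase of `h`
  -- survives only in the cross term of `‖h - m‖²`, a tilt whose average gives the series of `I_0`.
  have hin : ∀ h : ℂ, ∫⁻ u, cgaussPDF v (h - m) *
      ∏ i, cgaussPDF 1 (y i - h * shellPoint ρ u i) ∂(shellLaw n) =
      ENNReal.ofReal ((Real.pi ^ n)⁻¹ * Real.exp (-normSq y) * (Real.Gamma n / v) *
        Real.exp (-(‖m‖ ^ 2 / v)) * Real.pi⁻¹) *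
      ((ENNReal.ofReal (Real.exp (-(ρ * n + v⁻¹) * ‖h‖ ^ 2)) *
        sphereSeries n (normSq y * ρ * n * ‖h‖ ^ 2)) *
        ENNReal.ofReal (Real.exp (2 * inner ℝ (((v⁻¹ : ℝ) : ℂ) * m) h))) := by
    intro h
    simp_rw [prod_cgaussPDF_one, normSq_sub_shellPoint hρ.le y h]
    have hexp : ∀ r : ℝ, ENNReal.ofReal ((Real.pi ^ n)⁻¹ *
        Real.exp (-(normSq y + n * ρ * ‖h‖ ^ 2 - 2 * r))) =
        ENNReal.ofReal ((Real.pi ^ n)⁻¹ * Real.exp (-(normSq y + n * ρ * ‖h‖ ^ 2))) *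
          ENNReal.ofReal (Real.exp (2 * r)) := by
      intro r
      rw [← ENNReal.ofReal_mul (by positivity), mul_assoc (Real.pi ^ n)⁻¹, ← Real.exp_add]
      congr 3; ring
    simp_rw [hexp]
    rw [lintegral_const_mul _ (by fun_prop), lintegral_const_mul _ (by fun_prop),
      lintegral_shellLaw_exp_inner hn]
    have hnorm : ‖(starRingEnd ℂ (h * Real.sqrt (n * ρ))) •
        (WithLp.toLp 2 y : EuclideanSpace ℂ (Fin n))‖ ^ 2 = normSq y * ρ * n * ‖h‖ ^ 2 := by
      rw [norm_smul, RCLike.norm_conj, norm_mul, Complex.norm_real, Real.norm_eq_abs, mul_pow,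
        mul_pow, sq_abs, Real.sq_sqrt (by positivity), normSq_eq_norm_sq]
      ring
    have hm : ‖h - m‖ ^ 2 / v =
        v⁻¹ * ‖h‖ ^ 2 + ‖m‖ ^ 2 / v - 2 * inner ℝ (((v⁻¹ : ℝ) : ℂ) * m) h := by
      have : ((v⁻¹ : ℝ) : ℂ) * m = v⁻¹ • m := by simp
      rw [this, inner_smul_left, norm_sub_sq_real, real_inner_comm]
      simp only [conj_trivial]
      ring
    rw [hnorm, cgaussPDF, hm]
    generalize inner ℝ (((v⁻¹ : ℝ) : ℂ) * m) h = I
    generalize sphereSeries n (normSq y * ρ * n * ‖h‖ ^ 2) = S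
    have key : (Real.pi * v)⁻¹ * Real.exp (-(v⁻¹ * ‖h‖ ^ 2 + ‖m‖ ^ 2 / v - 2 * I)) *
        ((Real.pi ^ n)⁻¹ * Real.exp (-(normSq y + n * ρ * ‖h‖ ^ 2)) * Real.Gamma n) =
        (Real.pi ^ n)⁻¹ * Real.exp (-normSq y) * (Real.Gamma n / v) *
        Real.exp (-(‖m‖ ^ 2 / v)) * Real.pi⁻¹ *
        (Real.exp (-(ρ * n + v⁻¹) * ‖h‖ ^ 2) * Real.exp (2 * I)) := by
      have : Real.exp (-(v⁻¹ * ‖h‖ ^ 2 + ‖m‖ ^ 2 / v - 2 * I)) *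
          Real.exp (-(normSq y + n * ρ * ‖h‖ ^ 2)) = Real.exp (-normSq y) *
          Real.exp (-(‖m‖ ^ 2 / v)) * Real.exp (-(ρ * n + v⁻¹) * ‖h‖ ^ 2) * Real.exp (2 * I) := by
        simp only [← Real.exp_add]
        congr 1; ring
      calc _ = (Real.pi * v)⁻¹ * (Real.pi ^ n)⁻¹ * Real.Gamma n *
            (Real.exp (-(v⁻¹ * ‖h‖ ^ 2 + ‖m‖ ^ 2 / v - 2 * I)) *
              Real.exp (-(normSq y + n * ρ * ‖h‖ ^ 2))) := by ring
        _ = _ := by rw [this]; field_simp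
    rw [← mul_assoc (ENNReal.ofReal _) (ENNReal.ofReal (Real.Gamma n)), ← mul_assoc,
      ← ENNReal.ofReal_mul (by positivity), ← ENNReal.ofReal_mul (by positivity), key,
      mul_right_comm (ENNReal.ofReal _) S, ← mul_assoc (ENNReal.ofReal _) _ S,
      ← ENNReal.ofReal_mul (by positivity), ← ENNReal.ofReal_mul (by positivity)]
  simp_rw [hin]
  rw [lintegral_const_mul _ (by fun_prop), lintegral_complex_radial_mul_exp
    (fun z => ENNReal.ofReal (Real.exp (-(ρ * n + v⁻¹) * z)) *
        sphereSeries n (normSq y * ρ * n * z)) (by fun_prop), lintegral_const_mul _ (by fun_prop),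
    ← mul_assoc, ← ENNReal.ofReal_mul (by positivity), inv_mul_cancel_right₀ hpi.ne']
  congr 1
  refine lintegral_congr fun z => ?_
  rw [mul_right_comm, norm_mul, Complex.norm_real, Real.norm_eq_abs, mul_pow, sq_abs]
  congr 3
  ring

/-! ### Rotation to the axis codeword -/

/-- Density of the output of a block with input `[√(n ρ), 0, …, 0]`. -/
def axisPDF {n : ℕ} (ρ v : ℝ) (m : ℂ) (i : Fin n) : ℂ → ℝ≥0∞ := fun z =>
  if (i : ℕ) = 0 then cgaussPDF (v * n * ρ + 1) (z - m * Real.sqrt (n * ρ)) else cgaussPDF 1 z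

theorem measurable_axisPDF {n : ℕ} (ρ v : ℝ) (m : ℂ) (i : Fin n) :
    Measurable (axisPDF ρ v m i) := by
  unfold axisPDF
  by_cases h : (i : ℕ) = 0
  · simp only [h, if_true]; fun_prop
  · simp only [h, if_false]; fun_prop

/-- Only coordinate 0 meets the fading. There signal and noise add to a Gaussian of variance `v * n
* ρ + 1`; the other coordinates are pure noise. -/
theorem outPDF_axis {n : ℕ} (hn : 0 < n) {ρ v : ℝ} (hρ : 0 < ρ) (hv : 0 < v) (m : ℂ)
    (y : Fin n → ℂ) :
    outPDF v m (fun i : Fin n => if (i : ℕ) = 0 then (Real.sqrt (n * ρ) : ℂ) else 0) y =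
      ∏ i, axisPDF ρ v m i (y i) := by
  obtain ⟨k, rfl⟩ : ∃ k, n = k + 1 := ⟨n - 1, by omega⟩
  simp only [outPDF, axisPDF, Fin.prod_univ_succ, Fin.val_zero, if_true, Fin.val_succ,
    Nat.add_eq_zero_iff, one_ne_zero, and_false, if_false, mul_zero, sub_zero, ← mul_assoc]
  rw [lintegral_mul_const _ (by fun_prop), lintegral_cgaussPDF_mul hv one_pos,
    Real.sq_sqrt (by positivity), mul_assoc v]

/-- The affine map that `wTilde` applies to a coordinate. -/
def coordMap {n : ℕ} (ρ : ℝ) (m : ℂ) (v : ℝ) (i : Fin n) : ℂ → ℂ := fun z =>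
  (if (i : ℕ) = 0 then m * (Real.sqrt (n * ρ) : ℂ) else 0) +
    ((if (i : ℕ) = 0 then Real.sqrt (v * n * ρ + 1) else 1 : ℝ) : ℂ) * z

theorem measurable_coordMap {n : ℕ} (ρ : ℝ) (m : ℂ) (v : ℝ) (i : Fin n) :
    Measurable (coordMap ρ m v i) := by
  unfold coordMap; fun_prop

theorem wTilde_eq_coordMap {n : ℕ} (ρ : ℝ) (m : ℂ) (v : ℝ) :
    wTilde ρ m v = fun (w : Fin n → ℂ) i => coordMap ρ m v i (w i) := by
  funext w i
  by_cases h : (i : ℕ) = 0 <;> simp [wTilde, coordMap, h]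

theorem measurable_wTilde {n : ℕ} (ρ : ℝ) (v : ℝ) :
    Measurable fun p : ℂ × (Fin n → ℂ) => wTilde ρ p.1 v p.2 := by
  refine measurable_pi_lambda _ fun i => ?_
  by_cases h : (i : ℕ) = 0
  · simp only [wTilde, h, if_true]; fun_prop
  · simp only [wTilde, h, if_false]; fun_prop

theorem noiseLaw_map_wTilde {n : ℕ} {ρ v : ℝ} (hρ : 0 < ρ) (hv : 0 < v) (m : ℂ) :
    (noiseLaw n).map (wTilde ρ m v) =
      (volume : Measure (Fin n → ℂ)).withDensity (fun y => ∏ i, axisPDF ρ v m i (y i)) := by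
  have hτ : 0 < v * n * ρ + 1 := by positivity
  have e : ∀ i : Fin n, (complexGaussian 0 1).map (coordMap ρ m v i) =
      volume.withDensity (axisPDF ρ v m i) := by
    intro i
    unfold coordMap
    rw [complexGaussian_zero_map _ _ _ zero_le_one]
    by_cases h : (i : ℕ) = 0
    · rw [if_pos h, if_pos h, Real.sq_sqrt hτ.le, mul_one, complexGaussian_eq_withDensity _ hτ]
      unfold axisPDF
      simp only [h, if_true]
    · rw [if_neg h, if_neg h, one_pow, mul_one, complexGaussian_eq_withDensity _ one_pos]
      unfold axisPDF
      simp only [h, if_false, sub_zero]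
  have hs' : ∀ i : Fin n, SigmaFinite ((complexGaussian 0 1).map (coordMap ρ m v i)) := fun i => by
    have := Measure.isProbabilityMeasure_map (μ := complexGaussian 0 1)
      (measurable_coordMap ρ m v i).aemeasurable
    infer_instance
  have hs : ∀ i : Fin n, SigmaFinite ((volume : Measure ℂ).withDensity (axisPDF ρ v m i)) :=
    fun i => e i ▸ hs' i
  rw [wTilde_eq_coordMap, noiseLaw,
    Measure.pi_map_pi (fun i => (measurable_coordMap ρ m v i).aemeasurable)]
  simp_rw [e]
  exact pi_withDensity _ _ (measurable_axisPDF ρ v m)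

/-- A unitary change of coordinates of `ℂⁿ`. -/
def unitaryMap {n : ℕ} (L : EuclideanSpace ℂ (Fin n) ≃ₗᵢ[ℂ] EuclideanSpace ℂ (Fin n))
    (y : Fin n → ℂ) : Fin n → ℂ := WithLp.ofLp (L (WithLp.toLp 2 y))

theorem measurePreserving_unitaryMap {n : ℕ}
    (L : EuclideanSpace ℂ (Fin n) ≃ₗᵢ[ℂ] EuclideanSpace ℂ (Fin n)) :
    MeasurePreserving (unitaryMap L) := by
  let e : EuclideanSpace ℂ (Fin n) ≃L[ℝ] (Fin n → ℂ) := PiLp.continuousLinearEquiv 2 ℝ fun _ => ℂ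
  let LR : EuclideanSpace ℂ (Fin n) ≃ₗᵢ[ℝ] EuclideanSpace ℂ (Fin n) :=
    { L.toLinearEquiv.restrictScalars ℝ with norm_map' := L.norm_map }
  let ν : Measure (Fin n → ℂ) := (volume : Measure (EuclideanSpace ℂ (Fin n))).map e
  have hν : ν.IsAddHaarMeasure := e.isAddHaarMeasure_map _
  have he : MeasurePreserving e volume ν := ⟨e.continuous.measurable, rfl⟩
  have hT : MeasurePreserving (unitaryMap L) ν ν := by
    have hs : MeasurePreserving e.symm ν volume := by
      refine ⟨e.symm.continuous.measurable, ?_⟩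
      rw [Measure.map_map e.symm.continuous.measurable e.continuous.measurable]
      simp
    exact he.comp (LR.measurePreserving.comp hs)
  -- By uniqueness of Haar measure the two volumes are proportional; the constant is irrelevant to
  -- invariance.
  rw [Measure.isAddLeftInvariant_eq_smul (volume : Measure (Fin n → ℂ)) ν]
  exact hT.smul_measure _

theorem normSq_unitaryMap {n : ℕ}
    (L : EuclideanSpace ℂ (Fin n) ≃ₗᵢ[ℂ] EuclideanSpace ℂ (Fin n)) (y : Fin n → ℂ) :
    normSq (unitaryMap L y) = normSq y := by
  rw [normSq_eq_norm_sq, normSq_eq_norm_sq, unitaryMap, WithLp.toLp_ofLp, L.norm_map]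

/-- Scalar fading commutes with unitary maps, and the noise density depends only on the norm. -/
theorem outPDF_unitaryMap {n : ℕ}
    (L : EuclideanSpace ℂ (Fin n) ≃ₗᵢ[ℂ] EuclideanSpace ℂ (Fin n)) (v : ℝ) (m : ℂ)
    (x y : Fin n → ℂ) : outPDF v m (unitaryMap L x) (unitaryMap L y) = outPDF v m x y := by
  refine lintegral_congr fun h => ?_
  congr 1
  rw [prod_cgaussPDF_one fun i => _ - _, prod_cgaussPDF_one fun i => _ - _]
  have e : (fun i => unitaryMap L y i - h * unitaryMap L x i) =
      unitaryMap L (fun i => y i - h * x i) := by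
    have : (WithLp.toLp 2 fun i => y i - h * x i : EuclideanSpace ℂ (Fin n)) =
        WithLp.toLp 2 y - h • WithLp.toLp 2 x := by ext i; simp
    funext i
    simp [unitaryMap, this]
  rw [e, normSq_unitaryMap]

/-- Coordinates in an orthonormal basis that begins with `u` send `u` to the first unit vector. -/
theorem exists_unitaryMap_shellPoint {n : ℕ} (hn : 0 < n) (ρ : ℝ)
    (u : Metric.sphere (0 : EuclideanSpace ℂ (Fin n)) 1) :
    ∃ L : EuclideanSpace ℂ (Fin n) ≃ₗᵢ[ℂ] EuclideanSpace ℂ (Fin n),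
      unitaryMap L (shellPoint ρ u) =
        fun i : Fin n => if (i : ℕ) = 0 then (Real.sqrt (n * ρ) : ℂ) else 0 := by
  have horth : Orthonormal ℂ (({⟨0, hn⟩} : Set (Fin n)).domRestrict
      fun _ => (u : EuclideanSpace ℂ (Fin n))) := by
    rw [orthonormal_iff_ite]
    rintro ⟨i, rfl⟩ ⟨k, rfl⟩
    simp [Set.domRestrict, inner_self_eq_norm_sq_to_K]
  obtain ⟨b, hb⟩ := horth.exists_orthonormalBasis_extension_of_card_eq
    (by rw [finrank_euclideanSpace_fin, Fintype.card_fin])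
  refine ⟨b.repr, ?_⟩
  funext i
  rw [unitaryMap, shellPoint_eq, map_smul, ← hb ⟨0, hn⟩ rfl, b.repr_self]
  by_cases h : (i : ℕ) = 0
  · have : i = ⟨0, hn⟩ := Fin.ext h
    simp [this]
  · have : i ≠ ⟨0, hn⟩ := fun h' => h (congrArg Fin.val h')
    simp [this, h]

theorem measurable_outPDF {n : ℕ} (v : ℝ) :
    Measurable fun p : ℂ × (Fin n → ℂ) × (Fin n → ℂ) => outPDF v p.1 p.2.1 p.2.2 := by
  unfold outPDF
  refine Measurable.lintegral_prod_right' (f := fun p : (ℂ × (Fin n → ℂ) × (Fin n → ℂ)) × ℂ =>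
    cgaussPDF v (p.2 - p.1.1) * ∏ i, cgaussPDF 1 (p.1.2.2 i - p.2 * p.1.2.1 i)) ?_
  exact Measurable.mul (by fun_prop) (Finset.measurable_prod _ fun i _ => by fun_prop)

theorem measurable_outPDF_comp {n : ℕ} (v : ℝ) {α : Type*} [MeasurableSpace α] {m : α → ℂ}
    {x y : α → Fin n → ℂ} (hm : Measurable m) (hx : Measurable x) (hy : Measurable y) :
    Measurable fun a => outPDF v (m a) (x a) (y a) := by
  have h := (measurable_outPDF v).comp (hm.prodMk (hx.prodMk hy))
  exact h

theorem measurable_shellPoint {n : ℕ} (ρ : ℝ) : Measurable (shellPoint (n := n) ρ) := by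
  unfold shellPoint
  fun_prop

theorem outPDF_shellPoint_ne_top {n : ℕ} (hn : 0 < n) {ρ v : ℝ} (hρ : 0 < ρ) (hv : 0 < v) (m : ℂ)
    (u : Metric.sphere (0 : EuclideanSpace ℂ (Fin n)) 1) (y : Fin n → ℂ) :
    outPDF v m (shellPoint ρ u) y ≠ ⊤ := by
  obtain ⟨L, hL⟩ := exists_unitaryMap_shellPoint hn ρ u
  rw [← outPDF_unitaryMap L, hL, outPDF_axis hn hρ hv]
  refine ENNReal.prod_ne_top fun i _ => ?_
  unfold axisPDF
  split_ifs <;> exact cgaussPDF_ne_top _ _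

theorem outPDF_shellPoint_ne_zero {n : ℕ} (hn : 0 < n) {ρ v : ℝ} (hρ : 0 < ρ) (hv : 0 < v) (m : ℂ)
    (u : Metric.sphere (0 : EuclideanSpace ℂ (Fin n)) 1) (y : Fin n → ℂ) :
    outPDF v m (shellPoint ρ u) y ≠ 0 := by
  obtain ⟨L, hL⟩ := exists_unitaryMap_shellPoint hn ρ u
  rw [← outPDF_unitaryMap L, hL, outPDF_axis hn hρ hv]
  refine Finset.prod_ne_zero_iff.2 fun i _ => ?_
  unfold axisPDF
  split_ifs
  · exact cgaussPDF_ne_zero (by positivity) _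
  · exact cgaussPDF_ne_zero one_pos _

/-- A bound of the output density that is uniform in the shell codeword. -/
theorem outPDF_shellPoint_le {n : ℕ} (ρ : ℝ) {v : ℝ} (hv : 0 < v) (m : ℂ)
    (u : Metric.sphere (0 : EuclideanSpace ℂ (Fin n)) 1) (y : Fin n → ℂ) :
    outPDF v m (shellPoint ρ u) y ≤ ENNReal.ofReal (Real.pi ^ n)⁻¹ := by
  have hpi := Real.pi_pos
  refine (lintegral_mono fun h => mul_le_mul_right
    (b := ∏ i, cgaussPDF 1 (y i - h * shellPoint ρ u i))
    (c := ENNReal.ofReal (Real.pi ^ n)⁻¹) ?_ _).trans ?_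
  · rw [prod_cgaussPDF_one fun i => _ - _]
    refine ENNReal.ofReal_le_ofReal (mul_le_of_le_one_right (by positivity) ?_)
    rw [Real.exp_le_one_iff, neg_nonpos]
    exact Finset.sum_nonneg fun i _ => by positivity
  · rw [lintegral_mul_const _ (by fun_prop), lintegral_cgaussPDF_sub hv, one_mul]

/-- The output density induced by shell codewords. -/
def mixPDF {n : ℕ} (ρ v : ℝ) (m : ℂ) (y : Fin n → ℂ) : ℝ≥0∞ :=
  ∫⁻ u, outPDF v m (shellPoint ρ u) y ∂(shellLaw n)

theorem mixPDF_ne_top {n : ℕ} (hn : 0 < n) (ρ : ℝ) {v : ℝ} (hv : 0 < v) (m : ℂ)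
    (y : Fin n → ℂ) : mixPDF ρ v m y ≠ ⊤ := by
  have := isProbabilityMeasure_shellLaw hn
  refine ne_top_of_le_ne_top (b := ENNReal.ofReal (Real.pi ^ n)⁻¹) ENNReal.ofReal_ne_top ?_
  refine (lintegral_mono fun u => outPDF_shellPoint_le ρ hv m u y).trans ?_
  simp

theorem mixPDF_ne_zero {n : ℕ} (hn : 0 < n) {ρ v : ℝ} (hρ : 0 < ρ) (hv : 0 < v) (m : ℂ)
    (y : Fin n → ℂ) : mixPDF ρ v m y ≠ 0 := by
  have := isProbabilityMeasure_shellLaw hn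
  intro h
  have hm : Measurable fun u => outPDF v m (shellPoint ρ u) y :=
    measurable_outPDF_comp v measurable_const (measurable_shellPoint ρ) measurable_const
  rw [mixPDF, lintegral_eq_zero_iff hm] at h
  obtain ⟨u, hu⟩ := h.exists
  exact outPDF_shellPoint_ne_zero hn hρ hv m u y hu

theorem measurable_mixPDF {n : ℕ} (hn : 0 < n) (ρ v : ℝ) :
    Measurable fun p : ℂ × (Fin n → ℂ) => mixPDF ρ v p.1 p.2 := by
  have := isProbabilityMeasure_shellLaw hn
  have h : Measurable fun p : (ℂ × (Fin n → ℂ)) × Metric.sphere (0 : EuclideanSpace ℂ (Fin n)) 1 =>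
      outPDF v p.1.1 (shellPoint ρ p.2) p.1.2 :=
    measurable_outPDF_comp v measurable_fst.fst ((measurable_shellPoint ρ).comp measurable_snd)
      measurable_fst.snd
  exact h.lintegral_prod_right' (ν := shellLaw n)

/-- The closed formula involves `y` only through its norm, so rotation invariance of `shellLaw` is
not needed. -/
theorem mixPDF_unitaryMap {n : ℕ} (hn : 0 < n) {ρ v : ℝ} (hρ : 0 < ρ) (hv : 0 < v) (m : ℂ)
    (L : EuclideanSpace ℂ (Fin n) ≃ₗᵢ[ℂ] EuclideanSpace ℂ (Fin n)) (y : Fin n → ℂ) :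
    mixPDF ρ v m (unitaryMap L y) = mixPDF ρ v m y := by
  rw [mixPDF, mixPDF, lintegral_outPDF_shellPoint hn hρ hv, lintegral_outPDF_shellPoint hn hρ hv,
    normSq_unitaryMap]

theorem prod_axisPDF_wTilde {n : ℕ} (hn : 0 < n) {ρ v : ℝ} (hρ : 0 < ρ) (hv : 0 < v) (m : ℂ)
    (w : Fin n → ℂ) :
    ∏ i, axisPDF ρ v m i (wTilde ρ m v w i) =
      ENNReal.ofReal ((v * n * ρ + 1)⁻¹ * ((Real.pi ^ n)⁻¹ * Real.exp (-normSq w))) := by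
  have hpi := Real.pi_pos
  have hτ : 0 < v * n * ρ + 1 := by positivity
  obtain ⟨k, rfl⟩ : ∃ k, n = k + 1 := ⟨n - 1, by omega⟩
  rw [ENNReal.ofReal_mul (by positivity), ← prod_cgaussPDF_one, Fin.prod_univ_succ,
    Fin.prod_univ_succ, ← mul_assoc]
  congr 1
  · simp only [axisPDF, wTilde, Fin.val_zero, if_true, add_sub_cancel_left, cgaussPDF]
    rw [← ENNReal.ofReal_mul (by positivity), norm_mul, Complex.norm_real, Real.norm_eq_abs,
      mul_pow, sq_abs, Real.sq_sqrt hτ.le]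
    congr 1
    have : (v * ((k + 1 : ℕ) : ℝ) * ρ + 1) * ‖w 0‖ ^ 2 / (v * ((k + 1 : ℕ) : ℝ) * ρ + 1) =
      ‖w 0‖ ^ 2 / 1 := by field_simp
    rw [this]
    field_simp

/-- The likelihood ratio at the output `wTilde` of the axis codeword. -/
theorem axisPDF_div_mixPDF {n : ℕ} (hn : 0 < n) {ρ v : ℝ} (hρ : 0 < ρ) (hv : 0 < v) (m : ℂ)
    (w : Fin n → ℂ) (hw : 0 < normSq (wTilde ρ m v w)) :
    (∏ i, axisPDF ρ v m i (wTilde ρ m v w i)) / mixPDF ρ v m (wTilde ρ m v w) =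
      ENNReal.ofReal (Real.exp (infoS ρ m v w)) := by
  have hpi := Real.pi_pos
  have hτ : 0 < v * n * ρ + 1 := by positivity
  have hG : 0 < Real.Gamma n := Real.Gamma_pos_of_pos (by exact_mod_cast hn)
  obtain ⟨t, ht⟩ : ∃ t, t = normSq (wTilde ρ m v w) := ⟨_, rfl⟩
  have hmix := lintegral_outPDF_shellPoint hn hρ hv m (wTilde ρ m v w)
  rw [← ht] at hmix
  change mixPDF ρ v m (wTilde ρ m v w) = _ at hmix
  have h0 := mixPDF_ne_zero hn hρ hv m (wTilde ρ m v w)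
  have h1 := mixPDF_ne_top hn ρ hv m (wTilde ρ m v w)
  rw [hmix] at h0 h1
  have hC : 0 < (Real.pi ^ n)⁻¹ * Real.exp (-t) * (Real.Gamma n / v) *
      Real.exp (-(‖m‖ ^ 2 / v)) := by positivity
  have hS0 : shellLIntegral n ρ m v t ≠ 0 := fun h => h0 (by rw [h, mul_zero])
  have hS1 : shellLIntegral n ρ m v t ≠ ⊤ := fun h => h1 (by
    rw [h, ENNReal.mul_top (ENNReal.ofReal_pos.2 hC).ne'])
  rw [← ht] at hw
  have hS := shellIntegral_eq_toReal hn hρ hw m hS1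
  have hSpos : 0 < shellIntegral n ρ m v t := by rw [hS]; exact ENNReal.toReal_pos hS0 hS1
  have hSof : shellLIntegral n ρ m v t = ENNReal.ofReal (shellIntegral n ρ m v t) := by
    rw [hS, ENNReal.ofReal_toReal hS1]
  rw [prod_axisPDF_wTilde hn hρ hv m w, hmix, hSof, ← ENNReal.ofReal_mul hC.le,
    ← ENNReal.ofReal_div_of_pos (by positivity),
    infoS, ← ht]
  generalize shellIntegral n ρ m v t = S at hSpos
  generalize Real.Gamma n = G at hG hC
  rw [Real.exp_sub, Real.exp_sub, Real.exp_log hSpos, Real.exp_log (by positivity),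
    Real.exp_sub, Real.exp_add, Real.exp_neg, Real.exp_neg, Real.exp_neg]
  congr 1
  field_simp

/-- The law of `wTilde` has a Lebesgue density and `n > 0`, so the origin is null. The closed
formula for the likelihood ratio needs a nonzero output. -/
theorem ae_normSq_wTilde_pos {n : ℕ} (hn : 0 < n) {ρ v : ℝ} (hρ : 0 < ρ) (hv : 0 < v) (m : ℂ) :
    ∀ᵐ w ∂(noiseLaw n), 0 < normSq (wTilde ρ m v w) := by
  have hm : Measurable (wTilde (n := n) ρ m v) :=
    (measurable_wTilde ρ v).comp measurable_prodMk_left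
  have : Nonempty (Fin n) := ⟨⟨0, hn⟩⟩
  have h0 : ∀ᵐ y ∂(noiseLaw n).map (wTilde ρ m v), y ≠ 0 := by
    rw [noiseLaw_map_wTilde hρ hv]
    refine (withDensity_absolutelyContinuous _ _).ae_le ?_
    have := Measure.pi_nullSingletonClass (μ := fun _ : Fin n => (volume : Measure ℂ)) ⟨0, hn⟩
    rw [volume_pi]
    exact Measure.ae_ne _ 0
  filter_upwards [ae_of_ae_map hm.aemeasurable h0] with w hw
  rw [normSq_eq_norm_sq]
  have : (WithLp.toLp 2 (wTilde ρ m v w) : EuclideanSpace ℂ (Fin n)) ≠ 0 := by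
    simpa using hw
  positivity

/-! ### Pilots and the view of the receiver -/

theorem lintegral_complexGaussian_zero_add {v : ℝ} (hv : 0 < v) (a : ℂ) (g : ℂ → ℝ≥0∞)
    (hg : Measurable g) :
    ∫⁻ e, g (a + e) ∂(complexGaussian 0 v) = ∫⁻ z, cgaussPDF v (z - a) * g z := by
  rw [complexGaussian_eq_withDensity 0 hv,
    lintegral_withDensity_eq_lintegral_mul _ (by fun_prop) (by fun_prop),
    ← lintegral_add_left_eq_self (fun z => cgaussPDF v (z - a) * g z) a]
  simp

theorem lintegral_noiseLaw_add {n : ℕ} (a : Fin n → ℂ) (g : (Fin n → ℂ) → ℝ≥0∞)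
    (hg : Measurable g) :
    ∫⁻ w, g (a + w) ∂(noiseLaw n) = ∫⁻ y, (∏ i, cgaussPDF 1 (y i - a i)) * g y := by
  have hm : Measurable fun w : Fin n → ℂ => ∏ i, cgaussPDF 1 (w i) :=
    Finset.measurable_prod _ fun i _ => by fun_prop
  rw [noiseLaw_eq_withDensity,
    lintegral_withDensity_eq_lintegral_mul _ hm (by fun_prop),
    ← lintegral_add_left_eq_self (fun y => (∏ i, cgaussPDF 1 (y i - a i)) * g y) a]
  simp

theorem noiseLaw_map_comp {n k : ℕ} (e : Fin k → Fin n) (he : Function.Injective e) :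
    (noiseLaw n).map (fun w i => w (e i)) = noiseLaw k := by
  have hind : iIndepFun (fun (i : Fin n) (w : Fin n → ℂ) => w i) (noiseLaw n) :=
    iIndepFun_pi (X := fun (_ : Fin n) (x : ℂ) => x) fun _ => aemeasurable_id
  have h := (iIndepFun_iff_map_fun_eq_pi_map fun i => (measurable_pi_apply (e i)).aemeasurable).1
    (hind.precomp he)
  rw [h, noiseLaw]
  congr 1
  funext i
  exact (measurePreserving_eval (fun _ : Fin n => complexGaussian 0 1) (e i)).map_eq

/-- Prepending `i₀` keeps the selection of coordinates injective, so the selected vector is again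
noise; its first entry is then split off. This separates the pilot noise from the data noise. -/
theorem noiseLaw_map_cons {n k : ℕ} (i₀ : Fin n) (e : Fin k → Fin n) (he : Function.Injective e)
    (h₀ : ∀ i, e i ≠ i₀) :
    (noiseLaw n).map (fun w => (w i₀, fun i => w (e i))) =
      (complexGaussian 0 1).prod (noiseLaw k) := by
  have hinj : Function.Injective (Fin.cons i₀ e : Fin (k + 1) → Fin n) :=
    Fin.cons_injective_iff.2 ⟨fun ⟨i, hi⟩ => h₀ i hi, he⟩
  have h1 := noiseLaw_map_comp _ hinj
  have h2 :=
    (measurePreserving_piFinSuccAbove (fun _ : Fin (k + 1) => complexGaussian 0 1) 0).map_eq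
  change (noiseLaw (k + 1)).map _ = _ at h2
  rw [← h1, Measure.map_map (MeasurableEquiv.measurable _) (by fun_prop)] at h2
  exact h2

theorem varH_pos {κ : ℝ} (hκ : 0 ≤ κ) : 0 < varH κ := by unfold varH; positivity

instance (κ ρ : ℝ) (np : ℕ) : IsProbabilityMeasure (estimateLaw κ np ρ) :=
  Measure.isProbabilityMeasure_map (by fun_prop)

instance (κ : ℝ) {n : ℕ} (x : Fin n → ℂ) : IsProbabilityMeasure (blockLaw κ x) :=
  Measure.isProbabilityMeasure_map (by fun_prop)

/-- The codeword of a block: a pilot symbol of energy `np * ρ`, zeros, and the data symbols. -/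
def pilotWord {nc np : ℕ} (ρ : ℝ) (x : Fin (nc - np) → ℂ) : Fin nc → ℂ := fun k =>
  if h : np ≤ k then x ⟨k - np, by omega⟩
  else if (k : ℕ) = 0 then (Real.sqrt (np * ρ) : ℂ) else 0

/-- Position of a data symbol in the block. -/
def dataIndex {nc np : ℕ} (i : Fin (nc - np)) : Fin nc := ⟨np + i, by omega⟩

theorem dataIndex_injective {nc np : ℕ} :
    Function.Injective (dataIndex : Fin (nc - np) → Fin nc) := by
  intro i j h
  have := congrArg Fin.val h
  simp only [dataIndex] at this
  exact Fin.ext (by omega)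

theorem pilotWord_dataIndex {nc np : ℕ} (ρ : ℝ) (x : Fin (nc - np) → ℂ) (i : Fin (nc - np)) :
    pilotWord ρ x (dataIndex i) = x i := by
  simp [pilotWord, dataIndex]

theorem normSq_pilotWord {nc np : ℕ} (hnp : np < nc) {ρ : ℝ} (hρ : 0 ≤ ρ)
    (x : Fin (nc - np) → ℂ) : normSq (pilotWord ρ x) = np * ρ + normSq x := by
  have h : np + (nc - np) = nc := by omega
  rw [normSq, ← Equiv.sum_comp (finCongr h), Fin.sum_univ_add]
  congr 1
  · rcases Nat.eq_zero_or_pos np with rfl | hp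
    · simp
    · obtain ⟨j, rfl⟩ : ∃ j, np = j + 1 := ⟨np - 1, by omega⟩
      rw [Fin.sum_univ_succ, Finset.sum_eq_zero, add_zero]
      · simp only [pilotWord, finCongr_apply, Fin.val_cast, Fin.val_castAdd, Fin.val_zero]
        rw [dif_neg (by omega), if_pos trivial, Complex.norm_real, Real.norm_eq_abs, sq_abs,
          Real.sq_sqrt (by positivity)]
      · intro i _
        have hi := i.2
        simp only [pilotWord, finCongr_apply, Fin.val_cast, Fin.val_castAdd, Fin.val_succ]
        rw [dif_neg (by omega), if_neg (by omega)]
        simp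
  · refine Finset.sum_congr rfl fun i _ => ?_
    exact congrArg (fun z : ℂ => ‖z‖ ^ 2) (pilotWord_dataIndex ρ x i)

theorem measurable_muP (κ : ℝ) (np : ℕ) (ρ : ℝ) : Measurable (muP κ np ρ) := by
  unfold muP
  split_ifs <;> fun_prop

theorem measurable_outPDF_muP {n : ℕ} (κ : ℝ) (np : ℕ) (ρ v : ℝ) (x : Fin n → ℂ) :
    Measurable fun z : ℂ × (Fin n → ℂ) => outPDF v (muP κ np ρ z.1) x z.2 := by
  have h : Measurable fun z : ℂ × (Fin n → ℂ) => muP κ np ρ z.1 :=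
    (measurable_muP κ np ρ).comp measurable_fst
  exact measurable_outPDF_comp v h measurable_const measurable_snd

theorem measurable_prod_cgaussPDF_sub {n : ℕ} (x : Fin n → ℂ) :
    Measurable fun p : ℂ × (Fin n → ℂ) => ∏ i, cgaussPDF 1 (p.2 i - p.1 * x i) :=
  Finset.measurable_prod _ fun i _ => by fun_prop

/-- Tonelli for a mixture: `a` is the density of the fading, `K h` that of the output given fading
`h`. -/
theorem lintegral_mul_lintegral_swap {α β : Type*} [MeasurableSpace α] [MeasurableSpace β]
    (μ : Measure α) (ν : Measure β) [SFinite μ] [SFinite ν] (a : α → ℝ≥0∞) (ha : Measurable a)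
    (K : α → β → ℝ≥0∞) (hK : Measurable fun p : α × β => K p.1 p.2) (g : β → ℝ≥0∞)
    (hg : Measurable g) :
    ∫⁻ h, g h ∂(ν.withDensity fun y => ∫⁻ h, a h * K h y ∂μ) =
      ∫⁻ h, ∫⁻ y, K h y * g y ∂ν ∂(μ.withDensity a) := by
  have hK1 : ∀ h, Measurable fun y => K h y := fun h => hK.comp (measurable_prodMk_left (x := h))
  have hK2 : ∀ y, Measurable fun h => K h y := fun y => hK.comp (measurable_prodMk_right (y := y))
  have hKg : Measurable fun p : α × β => K p.1 p.2 * g p.2 := hK.mul (hg.comp measurable_snd)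
  have haK : Measurable fun p : β × α => a p.2 * K p.2 p.1 :=
    (ha.comp measurable_snd).mul (hK.comp measurable_swap)
  rw [lintegral_withDensity_eq_lintegral_mul _ haK.lintegral_prod_right' hg,
    lintegral_withDensity_eq_lintegral_mul _ ha hKg.lintegral_prod_right']
  simp only [Pi.mul_apply]
  have e1 : ∀ y, (∫⁻ h, a h * K h y ∂μ) * g y = ∫⁻ h, a h * K h y * g y ∂μ := fun y =>
    (lintegral_mul_const _ (ha.mul (hK2 y))).symm
  have e2 : ∀ h, a h * ∫⁻ y, K h y * g y ∂ν = ∫⁻ y, a h * K h y * g y ∂ν := fun h => by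
    simp_rw [mul_assoc]
    exact (lintegral_const_mul _ ((hK1 h).mul hg)).symm
  simp_rw [e1, e2]
  exact lintegral_lintegral_swap (haK.mul (hg.comp measurable_fst)).aemeasurable

/-- Without pilots the decoder sees the data part of the block only. -/
theorem blockLaw_map_data {κ : ℝ} (hκ : 0 ≤ κ) {nc : ℕ} (ρ : ℝ) (x : Fin (nc - 0) → ℂ) :
    (blockLaw κ (pilotWord ρ x)).map (fun y => ((0 : ℂ), fun i => y (dataIndex i))) =
      ((Measure.dirac (0 : ℂ)).prod volume).withDensity
        (fun z => outPDF (varP κ 0 ρ) (muP κ 0 ρ z.1) x z.2) := by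
  have hv := varH_pos hκ
  have hm := measurable_outPDF_muP κ 0 ρ (varP κ 0 ρ) x
  refine Measure.ext_of_lintegral _ fun g hg => ?_
  have hg0 : Measurable fun y : Fin (nc - 0) → ℂ => g (0, y) := hg.comp measurable_prodMk_left
  have hnoise : ∀ h : ℂ, ∫⁻ w, g (0, fun i => (h • pilotWord ρ x + w) (dataIndex i))
      ∂(noiseLaw nc) = ∫⁻ y, (∏ i, cgaussPDF 1 (y i - h * x i)) * g (0, y) := by
    intro h
    have h1 := lintegral_noiseLaw_add (fun i => h * x i) _ hg0
    rw [← noiseLaw_map_comp dataIndex dataIndex_injective, lintegral_map (by fun_prop)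
      (by fun_prop)] at h1
    rw [← h1]
    refine lintegral_congr fun w => ?_
    congr 2
    funext i
    simp [pilotWord_dataIndex]
  have hmix := lintegral_mul_lintegral_swap (volume : Measure ℂ)
    (volume : Measure (Fin (nc - 0) → ℂ))
    (fun h : ℂ => cgaussPDF (varH κ) (h - (muH κ : ℂ))) (by fun_prop)
    (fun (h : ℂ) (y : Fin (nc - 0) → ℂ) => ∏ i, cgaussPDF 1 (y i - h * x i))
    (measurable_prod_cgaussPDF_sub x) _ hg0
  rw [lintegral_map hg (by fun_prop), blockLaw, lintegral_map (by fun_prop) (by fun_prop),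
    lintegral_prod _ (by fun_prop)]
  simp only [hnoise]
  rw [complexGaussian_eq_withDensity (muH κ : ℂ) hv]
  refine hmix.symm.trans ?_
  have hm0 : Measurable fun y : Fin (nc - 0) → ℂ => outPDF (varH κ) (muH κ : ℂ) x y :=
    measurable_outPDF_comp _ measurable_const measurable_const measurable_id
  -- The point mass removes the dummy estimate.
  rw [lintegral_withDensity_eq_lintegral_mul _ hm hg,
    lintegral_prod _ (hm.mul hg).aemeasurable,
    lintegral_dirac' _ (Measurable.lintegral_prod_right' (hm.mul hg))]
  exact lintegral_withDensity_eq_lintegral_mul _ hm0 hg0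

theorem varE_pos {np : ℕ} (hp : 0 < np) {ρ : ℝ} (hρ : 0 < ρ) : 0 < varE np ρ := by
  unfold varE; positivity

theorem estimateLaw_eq_withDensity {κ : ℝ} (hκ : 0 ≤ κ) {np : ℕ} (hp : 0 < np) {ρ : ℝ}
    (hρ : 0 < ρ) : estimateLaw κ np ρ =
      volume.withDensity (fun z => cgaussPDF (varH κ + varE np ρ) (z - muH κ)) := by
  have hv := varH_pos hκ
  have hu := varE_pos hp hρ
  refine Measure.ext_of_lintegral _ fun g hg => ?_
  rw [estimateLaw, lintegral_map hg (by fun_prop), lintegral_prod _ (by fun_prop),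
    lintegral_withDensity_eq_lintegral_mul _ (by fun_prop) hg]
  simp only [lintegral_complexGaussian_zero_add hu _ g hg, Pi.mul_apply]
  rw [complexGaussian_eq_withDensity _ hv, lintegral_withDensity_eq_lintegral_mul _ (by fun_prop)
    (Measurable.lintegral_prod_right' (f := fun p : ℂ × ℂ => cgaussPDF (varE np ρ) (p.2 - p.1) *
      g p.2) (by fun_prop))]
  simp only [Pi.mul_apply]
  have hm : ∀ h : ℂ, Measurable fun z : ℂ => cgaussPDF (varE np ρ) (z - h) * g z := fun h => by
    fun_prop
  simp_rw [← lintegral_const_mul _ (hm _)]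
  rw [lintegral_lintegral_swap (by fun_prop)]
  refine lintegral_congr fun z => ?_
  have h := lintegral_cgaussPDF_mul hv hu 1 (muH κ : ℂ) z
  simp only [Complex.ofReal_one, mul_one, one_pow] at h
  simp_rw [← mul_assoc]
  rw [lintegral_mul_const _ (by fun_prop), h]

theorem prod_complexGaussian_noiseLaw {v : ℝ} (hv : 0 < v) (n : ℕ) :
    (complexGaussian 0 v).prod (noiseLaw n) = ((volume : Measure ℂ).prod volume).withDensity
      (fun q : ℂ × (Fin n → ℂ) => cgaussPDF v q.1 * ∏ i, cgaussPDF 1 (q.2 i)) := by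
  rw [complexGaussian_eq_withDensity _ hv, noiseLaw_eq_withDensity, prod_withDensity (by fun_prop)
    (Finset.measurable_prod _ fun i _ => by fun_prop)]
  simp

/-- The decoder's view of a block: channel estimate and data part of the output. -/
theorem blockLaw_map_estimate {κ : ℝ} (hκ : 0 ≤ κ) {nc np : ℕ} (hp : 0 < np) (hnp : np < nc)
    {ρ : ℝ} (hρ : 0 < ρ) (x : Fin (nc - np) → ℂ) :
    (blockLaw κ (pilotWord ρ x)).map (fun y : Fin nc → ℂ =>
      ((((Real.sqrt (np * ρ))⁻¹ : ℝ) : ℂ) * y ⟨0, by omega⟩, fun i => y (dataIndex i))) =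
      ((estimateLaw κ np ρ).prod volume).withDensity
        (fun z => outPDF (varP κ np ρ) (muP κ np ρ z.1) x z.2) := by
  have hv := varH_pos hκ
  have hu := varE_pos hp hρ
  have hs : 0 < Real.sqrt (np * ρ) := Real.sqrt_pos.2 (by positivity)
  have hm := measurable_outPDF_muP κ np ρ (varP κ np ρ) x
  -- Dividing unit noise by the pilot amplitude leaves variance `1 / (np * ρ)`, which is `varE`.
  have hE : (complexGaussian 0 1).map (fun z => (((Real.sqrt (np * ρ))⁻¹ : ℝ) : ℂ) * z) =
      complexGaussian 0 (varE np ρ) := by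
    have := complexGaussian_zero_map 0 (Real.sqrt (np * ρ))⁻¹ 1 zero_le_one
    rw [inv_pow, Real.sq_sqrt (by positivity), mul_one] at this
    rw [varE, ← this]
    simp only [zero_add]
  have hlaw : (noiseLaw nc).map (fun w => ((((Real.sqrt (np * ρ))⁻¹ : ℝ) : ℂ) *
      w ⟨0, by omega⟩, fun i : Fin (nc - np) => w (dataIndex i))) =
      (complexGaussian 0 (varE np ρ)).prod (noiseLaw (nc - np)) := by
    have hsplit := noiseLaw_map_cons (⟨0, by omega⟩ : Fin nc) (dataIndex (np := np))
      dataIndex_injective (fun i h => by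
        have := congrArg Fin.val h
        simp only [dataIndex] at this
        omega)
    have hid : (noiseLaw (nc - np)).map (fun w => w) = noiseLaw (nc - np) := Measure.map_id
    rw [← hE, ← hid, Measure.map_prod_map _ _ (by fun_prop) (by fun_prop), ← hsplit,
      Measure.map_map (by fun_prop) (by fun_prop)]
    rfl
  refine Measure.ext_of_lintegral _ fun g hg => ?_
  have hK : Measurable fun p : ℂ × ℂ × (Fin (nc - np) → ℂ) =>
      cgaussPDF (varE np ρ) (p.2.1 - p.1) * ∏ i, cgaussPDF 1 (p.2.2 i - p.1 * x i) :=
    Measurable.mul (by fun_prop) (Finset.measurable_prod _ fun i _ => by fun_prop)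
  have hnoise : ∀ h : ℂ, ∫⁻ w, g ((((Real.sqrt (np * ρ))⁻¹ : ℝ) : ℂ) *
      (h • pilotWord ρ x + w) ⟨0, by omega⟩, fun i => (h • pilotWord ρ x + w) (dataIndex i))
      ∂(noiseLaw nc) = ∫⁻ q : ℂ × (Fin (nc - np) → ℂ), (cgaussPDF (varE np ρ) (q.1 - h) *
        ∏ i, cgaussPDF 1 (q.2 i - h * x i)) * g q ∂((volume : Measure ℂ).prod volume) := by
    intro h
    have e0 : ∀ w : Fin nc → ℂ, ((((Real.sqrt (np * ρ))⁻¹ : ℝ) : ℂ) *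
        (h • pilotWord ρ x + w) ⟨0, by omega⟩, fun i : Fin (nc - np) =>
          (h • pilotWord ρ x + w) (dataIndex i)) =
        (h, fun i : Fin (nc - np) => h * x i) +
          ((((Real.sqrt (np * ρ))⁻¹ : ℝ) : ℂ) * w ⟨0, by omega⟩, fun i => w (dataIndex i)) := by
      intro w
      have hs' : (Real.sqrt (np * ρ) : ℂ) ≠ 0 := by exact_mod_cast hs.ne'
      have : pilotWord ρ x ⟨0, by omega⟩ = (Real.sqrt (np * ρ) : ℂ) := by
        simp only [pilotWord]
        rw [dif_neg (by omega), if_pos trivial]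
      refine Prod.ext ?_ ?_
      · simp only [Prod.fst_add]
        rw [Pi.add_apply, Pi.smul_apply, this, smul_eq_mul, Complex.ofReal_inv]
        field_simp
      · funext i
        simp [pilotWord_dataIndex]
    simp_rw [e0]
    have hmp : Measurable fun q : ℂ × (Fin (nc - np) → ℂ) =>
        cgaussPDF (varE np ρ) q.1 * ∏ i, cgaussPDF 1 (q.2 i) :=
      Measurable.mul (by fun_prop) (Finset.measurable_prod _ fun i _ => by fun_prop)
    have h1 : ∫⁻ q, g ((h, fun i : Fin (nc - np) => h * x i) + q)
        ∂((complexGaussian 0 (varE np ρ)).prod (noiseLaw (nc - np))) =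
        ∫⁻ w, g ((h, fun i : Fin (nc - np) => h * x i) +
          ((((Real.sqrt (np * ρ))⁻¹ : ℝ) : ℂ) * w ⟨0, by omega⟩, fun i => w (dataIndex i)))
          ∂(noiseLaw nc) := by
      rw [← hlaw, lintegral_map (by fun_prop) (by fun_prop)]
    rw [← h1, prod_complexGaussian_noiseLaw hu,
      lintegral_withDensity_eq_lintegral_mul _ hmp (by fun_prop),
      ← lintegral_add_left_eq_self (μ := (volume : Measure ℂ).prod volume)
        (fun q : ℂ × (Fin (nc - np) → ℂ) =>
        (cgaussPDF (varE np ρ) (q.1 - h) * ∏ i, cgaussPDF 1 (q.2 i - h * x i)) * g q)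
        (h, fun i : Fin (nc - np) => h * x i)]
    simp
  have hmix := lintegral_mul_lintegral_swap (volume : Measure ℂ)
    ((volume : Measure ℂ).prod (volume : Measure (Fin (nc - np) → ℂ)))
    (fun h : ℂ => cgaussPDF (varH κ) (h - (muH κ : ℂ))) (by fun_prop)
    (fun (h : ℂ) (q : ℂ × (Fin (nc - np) → ℂ)) => cgaussPDF (varE np ρ) (q.1 - h) *
      ∏ i, cgaussPDF 1 (q.2 i - h * x i)) hK g hg
  rw [lintegral_map hg (by fun_prop), blockLaw, lintegral_map (by fun_prop) (by fun_prop),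
    lintegral_prod _ (by fun_prop)]
  simp only [hnoise]
  rw [complexGaussian_eq_withDensity (muH κ : ℂ) hv]
  refine hmix.symm.trans ?_
  rw [estimateLaw_eq_withDensity hκ hp hρ, prod_withDensity_left (by fun_prop),
    ← withDensity_mul _ (by fun_prop) hm]
  congr 2
  funext q
  -- Bayes' rule with gain 1: the joint density of fading and estimate is the density of the
  -- estimate times the posterior with parameters `muP` and `varP`.
  have hpost := fun h => cgaussPDF_mul_cgaussPDF hv hu 1 (muH κ : ℂ) h q.1
  simp only [Complex.ofReal_one, mul_one, one_pow] at hpost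
  simp only [Pi.mul_apply, outPDF, ← mul_assoc, hpost, varP, muP, if_neg hp.ne']
  simp only [mul_assoc]
  exact lintegral_const_mul _ (Measurable.mul (by fun_prop)
    (Finset.measurable_prod _ fun i _ => by fun_prop))

/-! ### The law of the likelihood ratio and shell codes -/

/-- The likelihood ratio of a block as a function of the channel estimate and the noise. -/
def likelihoodRatio {n : ℕ} (ρ v : ℝ) (m : ℂ → ℂ) (ω : ℂ × (Fin n → ℂ)) : ℝ≥0∞ :=
  (∏ i, axisPDF ρ v (m ω.1) i (wTilde ρ (m ω.1) v ω.2 i)) /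
    mixPDF ρ v (m ω.1) (wTilde ρ (m ω.1) v ω.2)

section

theorem measurable_prod_axisPDF {n : ℕ} (hn : 0 < n) {ρ v : ℝ} (hρ : 0 < ρ) (hv : 0 < v) :
    Measurable fun p : ℂ × (Fin n → ℂ) => ∏ i, axisPDF ρ v p.1 i (p.2 i) := by
  simp only [← outPDF_axis hn hρ hv]
  exact measurable_outPDF_comp v measurable_fst measurable_const measurable_snd

theorem measurable_likelihoodRatio {n : ℕ} (hn : 0 < n) {ρ v : ℝ} (hρ : 0 < ρ) (hv : 0 < v)
    {m : ℂ → ℂ} (hm : Measurable m) :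
    Measurable (likelihoodRatio (n := n) ρ v m) := by
  have h0 : Measurable fun ω : ℂ × (Fin n → ℂ) => (m ω.1, ω.2) :=
    (hm.comp measurable_fst).prodMk measurable_snd
  have h1 : Measurable fun ω : ℂ × (Fin n → ℂ) => (m ω.1, wTilde ρ (m ω.1) v ω.2) :=
    (hm.comp measurable_fst).prodMk ((measurable_wTilde ρ v).comp h0)
  have h2 := (measurable_prod_axisPDF hn hρ hv).comp h1
  have h3 := (measurable_mixPDF hn ρ v).comp h1
  exact h2.div h3

theorem likelihoodRatio_ae_eq {n : ℕ} (hn : 0 < n) {ρ v : ℝ} (hρ : 0 < ρ) (hv : 0 < v)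
    {m : ℂ → ℂ} (hm : Measurable m) (η : Measure ℂ) [IsProbabilityMeasure η] :
    ∀ᵐ ω ∂(η.prod (noiseLaw n)),
      likelihoodRatio ρ v m ω = ENNReal.ofReal (Real.exp (infoS ρ (m ω.1) v ω.2)) := by
  have h0 : Measurable fun ω : ℂ × (Fin n → ℂ) => (m ω.1, ω.2) :=
    (hm.comp measurable_fst).prodMk measurable_snd
  have h1 : Measurable fun ω : ℂ × (Fin n → ℂ) => wTilde ρ (m ω.1) v ω.2 :=
    (measurable_wTilde ρ v).comp h0
  have h2 : Measurable fun ω : ℂ × (Fin n → ℂ) => normSq (wTilde ρ (m ω.1) v ω.2) := by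
    unfold normSq
    exact Finset.measurable_sum _ fun i _ =>
      (((measurable_pi_apply i).comp h1).norm.pow_const 2)
  have h3 : ∀ᵐ ω ∂(η.prod (noiseLaw n)), 0 < normSq (wTilde ρ (m ω.1) v ω.2) := by
    rw [Measure.ae_prod_iff_ae_ae (measurableSet_lt measurable_const h2)]
    exact ae_of_all _ fun h => ae_normSq_wTilde_pos hn hρ hv (m h)
  filter_upwards [h3] with ω hω
  exact axisPDF_div_mixPDF hn hρ hv (m ω.1) ω.2 hω

/-- The density of channel estimate and block output given a shell codeword, relative to the law of
the estimate times Lebesgue measure. -/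
def blockPDF {n : ℕ} (ρ v : ℝ) (m : ℂ → ℂ) (u : Metric.sphere (0 : EuclideanSpace ℂ (Fin n)) 1)
    (z : ℂ × (Fin n → ℂ)) : ℝ≥0∞ := outPDF v (m z.1) (shellPoint ρ u) z.2

theorem measurable_blockPDF {n : ℕ} (ρ v : ℝ) {m : ℂ → ℂ} (hm : Measurable m) :
    Measurable fun p : Metric.sphere (0 : EuclideanSpace ℂ (Fin n)) 1 × ℂ × (Fin n → ℂ) =>
      blockPDF ρ v m p.1 p.2 := by
  have h1 : Measurable fun p : Metric.sphere (0 : EuclideanSpace ℂ (Fin n)) 1 × ℂ × (Fin n → ℂ) =>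
    m p.2.1 := hm.comp measurable_snd.fst
  exact measurable_outPDF_comp v h1 ((measurable_shellPoint ρ).comp measurable_fst)
    measurable_snd.snd

theorem measurable_blockPDF_right {n : ℕ} (ρ v : ℝ) {m : ℂ → ℂ} (hm : Measurable m)
    (u : Metric.sphere (0 : EuclideanSpace ℂ (Fin n)) 1) : Measurable (blockPDF ρ v m u) := by
  have h := (measurable_blockPDF ρ v hm).comp (measurable_prodMk_left (x := u))
  exact h

theorem measurable_blockPDF_left {n : ℕ} (ρ v : ℝ) {m : ℂ → ℂ} (hm : Measurable m)
    (z : ℂ × (Fin n → ℂ)) : Measurable fun u => blockPDF ρ v m u z := by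
  have h := (measurable_blockPDF ρ v hm).comp (measurable_prodMk_right (y := z))
  exact h

theorem measurable_mixPDF_estimate {n : ℕ} (hn : 0 < n) (ρ v : ℝ) {m : ℂ → ℂ} (hm : Measurable m) :
    Measurable fun z : ℂ × (Fin n → ℂ) => mixPDF ρ v (m z.1) z.2 := by
  have h := (measurable_mixPDF hn ρ v).comp ((hm.comp measurable_fst).prodMk measurable_snd)
  exact h

/-- A unitary map preserving volume, and the mixture density, carries `u` to the axis. The
right-hand side is therefore free of `u`. -/
theorem lintegral_outPDF_mul_div {n : ℕ} (hn : 0 < n) {ρ v : ℝ} (hρ : 0 < ρ) (hv : 0 < v) (μ : ℂ)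
    {f : ℝ≥0∞ → ℝ≥0∞} (hf : Measurable f) (u : Metric.sphere (0 : EuclideanSpace ℂ (Fin n)) 1) :
    ∫⁻ y, outPDF v μ (shellPoint ρ u) y *
        f (outPDF v μ (shellPoint ρ u) y / mixPDF ρ v μ y) =
      ∫⁻ w, f ((∏ i, axisPDF ρ v μ i (wTilde ρ μ v w i)) / mixPDF ρ v μ (wTilde ρ μ v w))
        ∂(noiseLaw n) := by
  obtain ⟨L, hLu⟩ := exists_unitaryMap_shellPoint hn ρ u
  have hax : Measurable fun y : Fin n → ℂ => ∏ i, axisPDF ρ v μ i (y i) :=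
    Finset.measurable_prod _ fun i _ => (measurable_axisPDF ρ v μ i).comp (measurable_pi_apply i)
  have hmx : Measurable fun y : Fin n → ℂ => mixPDF ρ v μ y := by
    have h := (measurable_mixPDF hn ρ v).comp (measurable_prodMk_left (x := μ))
    exact h
  have hfa : Measurable fun y : Fin n → ℂ =>
      f ((∏ i, axisPDF ρ v μ i (y i)) / mixPDF ρ v μ y) := hf.comp (hax.div hmx)
  have hwt : Measurable (wTilde (n := n) ρ μ v) := by
    have h := (measurable_wTilde (n := n) ρ v).comp (measurable_prodMk_left (x := μ))
    exact h
  have e : ∀ y : Fin n → ℂ, outPDF v μ (shellPoint ρ u) y =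
      ∏ i, axisPDF ρ v μ i (unitaryMap L y i) := by
    intro y
    rw [← outPDF_axis hn hρ hv, ← hLu, outPDF_unitaryMap]
  have e2 : ∀ y : Fin n → ℂ, outPDF v μ (shellPoint ρ u) y *
        f (outPDF v μ (shellPoint ρ u) y / mixPDF ρ v μ y) =
      ((fun y : Fin n → ℂ => ∏ i, axisPDF ρ v μ i (y i)) *
        fun y : Fin n → ℂ => f ((∏ i, axisPDF ρ v μ i (y i)) / mixPDF ρ v μ y))
          (unitaryMap L y) := by
    intro y
    simp only [e, Pi.mul_apply, mixPDF_unitaryMap hn hρ hv]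
  have h1 := lintegral_withDensity_eq_lintegral_mul (volume : Measure (Fin n → ℂ)) hax hfa
  rw [lintegral_congr e2, (measurePreserving_unitaryMap L).lintegral_comp (hax.mul hfa),
    ← lintegral_map hfa hwt, noiseLaw_map_wTilde hρ hv, h1]

theorem map_blockPDF_div {n : ℕ} (hn : 0 < n) {ρ v : ℝ} (hρ : 0 < ρ) (hv : 0 < v)
    {m : ℂ → ℂ} (hm : Measurable m) (η : Measure ℂ) [IsProbabilityMeasure η]
    (u : Metric.sphere (0 : EuclideanSpace ℂ (Fin n)) 1) :
    ((η.prod volume).withDensity (blockPDF ρ v m u)).map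
      (fun z => blockPDF ρ v m u z / mixPDF ρ v (m z.1) z.2) =
      (η.prod (noiseLaw n)).map (likelihoodRatio ρ v m) := by
  have hp := measurable_blockPDF_right ρ v hm u
  have hq := measurable_mixPDF_estimate hn ρ v hm
  have hL := measurable_likelihoodRatio hn hρ hv hm
  refine Measure.ext_of_lintegral _ fun f hf => ?_
  have hpq : Measurable fun z : ℂ × (Fin n → ℂ) =>
      blockPDF ρ v m u z / mixPDF ρ v (m z.1) z.2 := hp.div hq
  have hfr : Measurable fun z : ℂ × (Fin n → ℂ) =>
      f (blockPDF ρ v m u z / mixPDF ρ v (m z.1) z.2) := hf.comp hpq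
  have hfL : Measurable fun ω : ℂ × (Fin n → ℂ) => f (likelihoodRatio ρ v m ω) := hf.comp hL
  have hR : ∫⁻ ω, f (likelihoodRatio ρ v m ω) ∂(η.prod (noiseLaw n)) =
      ∫⁻ h, ∫⁻ w, f (likelihoodRatio ρ v m (h, w)) ∂(noiseLaw n) ∂η :=
    lintegral_prod _ hfL.aemeasurable
  rw [lintegral_map hf hpq, lintegral_map hf hL,
    lintegral_withDensity_eq_lintegral_mul _ hp hfr, lintegral_prod _ (hp.mul hfr).aemeasurable, hR]
  refine lintegral_congr fun h => ?_
  have h1 := lintegral_outPDF_mul_div hn hρ hv (m h) hf u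
  simp only [Pi.mul_apply, blockPDF, likelihoodRatio]
  exact h1

end

theorem dtTerm_eq_min (M : ℕ) (s : ℝ) :
    dtTerm M s = min 1 (ENNReal.ofReal (((M : ℝ) - 1) / 2) / ENNReal.ofReal (Real.exp s)) := by
  have hmin : ∀ a : EReal, EReal.exp (-(max 0 a)) = min 1 (EReal.exp (-a)) := by
    intro a
    rcases le_total 0 a with h | h
    · rw [max_eq_right h, min_eq_right]
      rw [EReal.exp_le_one_iff]
      simpa using EReal.neg_le_neg_iff.2 h
    · rw [max_eq_left h, min_eq_left]
      · simp
      · rw [EReal.one_le_exp_iff]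
        simpa using EReal.neg_le_neg_iff.2 h
  rw [dtTerm, hmin]
  congr 1
  rcases le_or_gt (((M : ℝ) - 1) / 2) 0 with h | h
  -- Here `M ≤ 1`: the logarithm is `-∞` and both sides are `0`.
  · rw [ENNReal.ofReal_of_nonpos h, ENNReal.log_zero, ENNReal.zero_div]
    simp
  · rw [ENNReal.log_ofReal_of_pos h, ← EReal.coe_sub, ← EReal.coe_neg, EReal.exp_coe,
      ← ENNReal.ofReal_div_of_pos (Real.exp_pos s), neg_sub, Real.exp_sub, Real.exp_log h]

theorem ae_pi_of_ae {X : Type*} [MeasurableSpace X] {l : ℕ} (μ : Measure X)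
    [IsProbabilityMeasure μ] {p : X → Prop} (hp : ∀ᵐ x ∂μ, p x) :
    ∀ᵐ ω ∂(Measure.pi fun _ : Fin l => μ), ∀ k, p (ω k) :=
  ae_all_iff.2 fun k =>
    (measurePreserving_eval (fun _ : Fin l => μ) k).quasiMeasurePreserving.ae hp

section

variable {n : ℕ} {ρ v : ℝ} {m : ℂ → ℂ}

theorem dtTerm_ae_eq (hn : 0 < n) (hρ : 0 < ρ) (hv : 0 < v) (hm : Measurable m) (η : Measure ℂ)
    [IsProbabilityMeasure η] (l M : ℕ) :
    ∀ᵐ ω ∂(Measure.pi fun _ : Fin l => η.prod (noiseLaw n)),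
      dtTerm M (∑ k, infoS ρ (m (ω k).1) v (ω k).2) =
        min 1 (ENNReal.ofReal (((M : ℝ) - 1) / 2) / ∏ k, likelihoodRatio ρ v m (ω k)) := by
  filter_upwards [ae_pi_of_ae _ (likelihoodRatio_ae_eq hn hρ hv hm η)] with ω hω
  rw [dtTerm_eq_min, Real.exp_sum, ENNReal.ofReal_prod_of_nonneg fun _ _ => Real.exp_nonneg _]
  simp only [hω]

theorem measurable_min_div_prod {l : ℕ} {X : Type*} [MeasurableSpace X] (γ : ℝ≥0∞)
    {f : X → ℝ≥0∞} (hf : Measurable f) :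
    Measurable fun ω : Fin l → X => min 1 (γ / ∏ k, f (ω k)) :=
  measurable_const.min (measurable_const.div
    (Finset.measurable_prod _ fun k _ => hf.comp (measurable_pi_apply k)))

/-- The integrand sees each block only through its ratio, so equality of the one-block laws is
enough to compare integrals. -/
theorem lintegral_min_div_prod {l : ℕ} {X : Type*} [MeasurableSpace X] (γ : ℝ≥0∞)
    (μ : Fin l → Measure X) [∀ k, SigmaFinite (μ k)] {f : Fin l → X → ℝ≥0∞}
    (hf : ∀ k, Measurable (f k)) [∀ k, SigmaFinite ((μ k).map (f k))] :
    ∫⁻ ω, min 1 (γ / ∏ k, f k (ω k)) ∂(Measure.pi μ) =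
      ∫⁻ t, min 1 (γ / ∏ k, t k) ∂(Measure.pi fun k => (μ k).map (f k)) := by
  have hF : Measurable fun t : Fin l → ℝ≥0∞ => min 1 (γ / ∏ k, t k) := by
    have h := measurable_min_div_prod (l := l) γ (measurable_id (α := ℝ≥0∞))
    simpa only [id] using h
  have hG : Measurable fun (ω : Fin l → X) k => f k (ω k) :=
    measurable_pi_lambda _ fun k => (hf k).comp (measurable_pi_apply k)
  rw [← Measure.pi_map_pi fun k => (hf k).aemeasurable, lintegral_map hF hG]

/-- Measurability comes from the likelihood ratio, with which `infoS` agrees almost everywhere after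
exponentiation. -/
theorem aemeasurable_dtTerm (hn : 0 < n) (hρ : 0 < ρ) (hv : 0 < v) (hm : Measurable m)
    (η : Measure ℂ) [IsProbabilityMeasure η] (l M : ℕ) :
    AEMeasurable (fun ω : Fin l → ℂ × (Fin n → ℂ) =>
      dtTerm M (∑ k, infoS ρ (m (ω k).1) v (ω k).2))
      (Measure.pi fun _ : Fin l => η.prod (noiseLaw n)) :=
  ⟨_, measurable_min_div_prod _ (measurable_likelihoodRatio hn hρ hv hm),
    dtTerm_ae_eq hn hρ hv hm η l M⟩

/-- The dependence-testing bound for shell codes over a block-fading channel whose decoder knows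
channel estimates of law `η`, where the fading law given the estimate `h` is `CN(m h, v)`. -/
theorem exists_shell_code (hn : 0 < n) (hρ : 0 < ρ) (hv : 0 < v) (hm : Measurable m)
    (η : Measure ℂ) [IsProbabilityMeasure η] (l : ℕ) {M : ℕ} (hM : 0 < M) :
    ∃ (c : Fin M → Fin l → Metric.sphere (0 : EuclideanSpace ℂ (Fin n)) 1)
      (dec : (Fin l → ℂ × (Fin n → ℂ)) → Fin M), Measurable dec ∧
      ∑ j, (Measure.pi fun k => (η.prod volume).withDensity (blockPDF ρ v m (c j k)))
        {y | dec y ≠ j} ≤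
      M * ∫⁻ ω, dtTerm M (∑ k, infoS ρ (m (ω k).1) v (ω k).2)
        ∂(Measure.pi fun _ : Fin l => η.prod (noiseLaw n)) := by
  have := isProbabilityMeasure_shellLaw hn
  have hp := measurable_blockPDF (n := n) ρ v hm
  have hpr := fun u => measurable_blockPDF_right (n := n) ρ v hm u
  have hpt : ∀ u z, blockPDF (n := n) ρ v m u z ≠ ⊤ := fun u z =>
    outPDF_shellPoint_ne_top hn hρ hv _ u _
  have hq := measurable_mixPDF_estimate hn ρ v hm
  let P : (Fin l → Metric.sphere (0 : EuclideanSpace ℂ (Fin n)) 1) →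
      (Fin l → ℂ × (Fin n → ℂ)) → ℝ≥0∞ := fun x y => ∏ k, blockPDF ρ v m (x k) (y k)
  have hP : Measurable (Function.uncurry P) := by
    have : Measurable fun z : (Fin l → Metric.sphere (0 : EuclideanSpace ℂ (Fin n)) 1) ×
        (Fin l → ℂ × (Fin n → ℂ)) => ∏ k, blockPDF ρ v m (z.1 k) (z.2 k) := by
      refine Finset.measurable_prod _ fun k _ => ?_
      have h0 : Measurable fun z : (Fin l → Metric.sphere (0 : EuclideanSpace ℂ (Fin n)) 1) ×
          (Fin l → ℂ × (Fin n → ℂ)) => (z.1 k, z.2 k) :=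
        ((measurable_pi_apply k).comp measurable_fst).prodMk
          ((measurable_pi_apply k).comp measurable_snd)
      have h := hp.comp h0
      exact h
    exact this
  have hsf : ∀ u, SigmaFinite ((η.prod volume).withDensity (blockPDF (n := n) ρ v m u)) := fun u =>
    SigmaFinite.withDensity_of_ne_top' (hpt u)
  obtain ⟨c, dec, hdec, herr⟩ := exists_codebook
    (Measure.pi fun _ : Fin l => shellLaw n)
    (Measure.pi fun _ : Fin l => η.prod (volume : Measure (Fin n → ℂ))) P hP
    (fun x y => ENNReal.prod_ne_top fun k _ => hpt _ _)
    (fun y => ∏ k, mixPDF ρ v (m (y k).1) (y k).2)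
    (fun y => lintegral_pi_prod (fun _ => shellLaw n) (fun k u => blockPDF ρ v m u (y k))
      fun k => measurable_blockPDF_left ρ v hm (y k))
    (fun y => Finset.prod_ne_zero_iff.2 fun k _ => mixPDF_ne_zero hn hρ hv _ _)
    (fun y => ENNReal.prod_ne_top fun k _ => mixPDF_ne_top hn ρ hv _ _) hM
  have hpi : ∀ x : Fin l → Metric.sphere (0 : EuclideanSpace ℂ (Fin n)) 1,
      (Measure.pi fun _ : Fin l => η.prod (volume : Measure (Fin n → ℂ))).withDensity (P x) =
        Measure.pi fun k => (η.prod volume).withDensity (blockPDF ρ v m (x k)) := fun x =>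
    (pi_withDensity (fun _ => η.prod volume) (fun k => blockPDF ρ v m (x k))
      fun k => hpr (x k)).symm
  refine ⟨c, dec, hdec, ?_⟩
  simp only [hpi] at herr
  refine herr.trans (le_of_eq ?_)
  congr 1
  set γ := ENNReal.ofReal (((M : ℝ) - 1) / 2)
  have hprob : IsProbabilityMeasure ((η.prod (noiseLaw n)).map (likelihoodRatio ρ v m)) :=
    Measure.isProbabilityMeasure_map (measurable_likelihoodRatio hn hρ hv hm).aemeasurable
  have hLR : ∫⁻ ω, dtTerm M (∑ k, infoS ρ (m (ω k).1) v (ω k).2)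
        ∂(Measure.pi fun _ : Fin l => η.prod (noiseLaw n)) =
      ∫⁻ t, min 1 (γ / ∏ k, t k)
        ∂(Measure.pi fun _ : Fin l => (η.prod (noiseLaw n)).map (likelihoodRatio ρ v m)) := by
    rw [lintegral_congr_ae (dtTerm_ae_eq hn hρ hv hm η l M)]
    exact lintegral_min_div_prod γ (fun _ : Fin l => η.prod (noiseLaw n))
      (f := fun _ => likelihoodRatio ρ v m) fun _ => measurable_likelihoodRatio hn hρ hv hm
  rw [hLR]
  -- The inner integral is the same for every codeword `x`, so the average over codewords is
  -- trivial.
  have hx : ∀ x, ∫⁻ y, P x y * min 1 (γ / (P x y / ∏ k, mixPDF ρ v (m (y k).1) (y k).2))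
      ∂(Measure.pi fun _ : Fin l => η.prod (volume : Measure (Fin n → ℂ))) =
      ∫⁻ t, min 1 (γ / ∏ k, t k)
        ∂(Measure.pi fun _ : Fin l => (η.prod (noiseLaw n)).map (likelihoodRatio ρ v m)) := by
    intro x
    have hPx : Measurable (P x) := hP.of_uncurry_left
    have hr : ∀ k, Measurable fun z : ℂ × (Fin n → ℂ) =>
        blockPDF ρ v m (x k) z / mixPDF ρ v (m z.1) z.2 := fun k => (hpr (x k)).div hq
    have hrr : Measurable fun y : Fin l → ℂ × (Fin n → ℂ) =>
        min 1 (γ / ∏ k, (blockPDF ρ v m (x k) (y k) / mixPDF ρ v (m (y k).1) (y k).2)) :=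
      measurable_const.min (measurable_const.div
        (Finset.measurable_prod _ fun k _ => (hr k).comp (measurable_pi_apply k)))
    -- This law is a probability measure because it equals the law of `likelihoodRatio`.
    have hsf2 : ∀ k, SigmaFinite (((η.prod volume).withDensity (blockPDF ρ v m (x k))).map
        (fun z => blockPDF ρ v m (x k) z / mixPDF ρ v (m z.1) z.2)) := fun k => by
      rw [map_blockPDF_div hn hρ hv hm]; infer_instance
    have e : ∀ y : Fin l → ℂ × (Fin n → ℂ),
        P x y / ∏ k, mixPDF ρ v (m (y k).1) (y k).2 =
        ∏ k, (blockPDF ρ v m (x k) (y k) / mixPDF ρ v (m (y k).1) (y k).2) := by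
      intro y
      simp only [P, div_eq_mul_inv, Finset.prod_mul_distrib]
      rw [ENNReal.prod_inv_distrib]
      intro i _ j _ _
      exact Or.inl (mixPDF_ne_zero hn hρ hv _ _)
    simp_rw [e]
    have h1 := lintegral_withDensity_eq_lintegral_mul
      (Measure.pi fun _ : Fin l => η.prod (volume : Measure (Fin n → ℂ))) hPx hrr
    simp only [Pi.mul_apply] at h1
    rw [← h1, hpi]
    rw [lintegral_min_div_prod γ _ hr]
    congr 2
    funext k
    exact map_blockPDF_div hn hρ hv hm η (x k)
  simp_rw [hx]
  simp

end

/-! ### Behaviour of the error bound in `M` -/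

theorem varP_pos {κ : ℝ} (hκ : 0 ≤ κ) (np : ℕ) {ρ : ℝ} (hρ : 0 < ρ) : 0 < varP κ np ρ := by
  have hv := varH_pos hκ
  unfold varP
  split_ifs with h
  · exact hv
  · have he := varE_pos (Nat.pos_of_ne_zero h) hρ
    positivity

theorem dtTerm_mono {M N : ℕ} (h : M ≤ N) (s : ℝ) : dtTerm M s ≤ dtTerm N s := by
  have hMN : (M : ℝ) ≤ N := by exact_mod_cast h
  rw [dtTerm_eq_min, dtTerm_eq_min]
  gcongr

theorem dtTerm_one (s : ℝ) : dtTerm 1 s = 0 := by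
  simp [dtTerm_eq_min]

theorem iSup_dtTerm (s : ℝ) : ⨆ M, dtTerm M s = 1 := by
  refine le_antisymm (iSup_le fun M => by rw [dtTerm_eq_min]; exact min_le_left _ _) ?_
  obtain ⟨M, hM⟩ := exists_nat_ge (2 * Real.exp s + 1)
  refine le_iSup_of_le M ?_
  rw [dtTerm_eq_min, ← ENNReal.ofReal_div_of_pos (Real.exp_pos s)]
  refine le_min le_rfl ?_
  rw [ENNReal.one_le_ofReal, one_le_div (Real.exp_pos s)]
  linarith

theorem epsUB_mono (κ : ℝ) (l nc np : ℕ) (ρ : ℝ) : Monotone (epsUB κ l nc np ρ) :=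
  fun _ _ h => lintegral_mono fun _ => dtTerm_mono h _

theorem epsUB_one (κ : ℝ) (l nc np : ℕ) (ρ : ℝ) : epsUB κ l nc np ρ 1 = 0 := by
  simp [epsUB, dtTerm_one]

/-- Monotone convergence: for each noise realisation the integrand rises to 1, since any finite
information density is eventually exceeded by the threshold. -/
theorem iSup_epsUB {κ ρ : ℝ} {l nc np : ℕ} (hκ : 0 ≤ κ) (hρ : 0 < ρ) (hnp : np < nc) :
    ⨆ M, epsUB κ l nc np ρ M = 1 := by
  unfold epsUB
  rw [← lintegral_iSup' (fun M => aemeasurable_dtTerm (Nat.sub_pos_of_lt hnp) hρ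
    (varP_pos hκ np hρ) (measurable_muP κ np ρ) _ l M)
    (ae_of_all _ fun ω _ _ h => dtTerm_mono h _)]
  simp [iSup_dtTerm]

theorem map_prod_const {X Y : Type*} [MeasurableSpace X] [MeasurableSpace Y] (η : Measure X)
    (ν : Measure Y) [IsProbabilityMeasure η] [SigmaFinite ν] (a : X) :
    (η.prod ν).map (fun ω => (a, ω.2)) = (Measure.dirac a).prod ν := by
  have h := Measure.map_prod_map η ν (measurable_const (a := a)) measurable_id
  rw [Measure.map_id, Measure.map_const, measure_univ, one_smul] at h
  exact h.symm

/-- Without pilots `muP` is constant, so the law of the estimate may be replaced by a point mass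
without changing the bound. -/
theorem lintegral_dtTerm_dirac {κ ρ : ℝ} {nc : ℕ} (hκ : 0 ≤ κ) (hρ : 0 < ρ) (hnc : 0 < nc)
    (l M : ℕ) :
    ∫⁻ ω : Fin l → ℂ × (Fin (nc - 0) → ℂ),
      dtTerm M (∑ k, infoS ρ (muP κ 0 ρ (ω k).1) (varP κ 0 ρ) (ω k).2)
      ∂(Measure.pi fun _ => (Measure.dirac (0 : ℂ)).prod (noiseLaw (nc - 0))) =
      epsUB κ l nc 0 ρ M := by
  have hT : Measurable fun ω : ℂ × (Fin (nc - 0) → ℂ) => ((0 : ℂ), ω.2) :=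
    measurable_const.prodMk measurable_snd
  have hmap : ((estimateLaw κ 0 ρ).prod (noiseLaw (nc - 0))).map (fun ω => ((0 : ℂ), ω.2)) =
      (Measure.dirac (0 : ℂ)).prod (noiseLaw (nc - 0)) :=
    map_prod_const _ _ _
  have hsf : SigmaFinite
      (((estimateLaw κ 0 ρ).prod (noiseLaw (nc - 0))).map (fun ω => ((0 : ℂ), ω.2))) := by
    rw [hmap]; infer_instance
  have hpi := Measure.pi_map_pi
    (μ := fun _ : Fin l => (estimateLaw κ 0 ρ).prod (noiseLaw (nc - 0)))
    (f := fun _ ω => ((0 : ℂ), ω.2)) (hμ := fun _ => hsf) fun _ => hT.aemeasurable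
  simp only [hmap] at hpi
  have hTT : Measurable fun (ω : Fin l → ℂ × (Fin (nc - 0) → ℂ)) k => ((0 : ℂ), (ω k).2) :=
    measurable_pi_lambda _ fun k => hT.comp (measurable_pi_apply k)
  have hae := aemeasurable_dtTerm (n := nc - 0) hnc hρ (varP_pos hκ 0 hρ) (measurable_muP κ 0 ρ)
    (Measure.dirac (0 : ℂ)) l M
  rw [← hpi] at hae ⊢
  rw [lintegral_map' hae hTT.aemeasurable, epsUB]
  simp [muP]

/-! ### Codes for the original channel -/

/-- The receiver's front end: a channel estimate, whose law is `η`, and the data part of the block,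
together having the shell-code likelihoods. -/
theorem exists_observation {κ ρ : ℝ} {nc np : ℕ} (hκ : 0 ≤ κ) (hρ : 0 < ρ) (hnp : np < nc)
    (l : ℕ) :
    ∃ (T : (Fin nc → ℂ) → ℂ × (Fin (nc - np) → ℂ)) (η : Measure ℂ),
      Measurable T ∧ IsProbabilityMeasure η ∧
      (∀ u, (blockLaw κ (pilotWord ρ (shellPoint ρ u))).map T =
        (η.prod volume).withDensity (blockPDF ρ (varP κ np ρ) (muP κ np ρ) u)) ∧
      ∀ M, ∫⁻ ω : Fin l → ℂ × (Fin (nc - np) → ℂ),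
        dtTerm M (∑ k, infoS ρ (muP κ np ρ (ω k).1) (varP κ np ρ) (ω k).2)
        ∂(Measure.pi fun _ => η.prod (noiseLaw (nc - np))) = epsUB κ l nc np ρ M := by
  rcases Nat.eq_zero_or_pos np with rfl | hp
  · exact ⟨_, Measure.dirac 0,
      measurable_const.prodMk (measurable_pi_lambda _ fun i => measurable_pi_apply _),
      inferInstance, fun u => blockLaw_map_data hκ ρ _, lintegral_dtTerm_dirac hκ hρ hnp l⟩
  · exact ⟨_, estimateLaw κ np ρ,
      ((measurable_pi_apply _).const_mul _).prodMk
        (measurable_pi_lambda _ fun i => measurable_pi_apply _),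
      inferInstance, fun u => blockLaw_map_estimate hκ hp hnp hρ _, fun M => rfl⟩

/-- The shell code is prefixed by pilots and its decoder is composed with the blockwise front end
`T`. Pilot and data energies add up to `nc * ρ`. -/
theorem nonempty_code {κ ρ ε : ℝ} {l nc np M : ℕ} (hκ : 0 ≤ κ) (hρ : 0 < ρ) (hnp : np < nc)
    (hε : 0 ≤ ε) (hM : 0 < M) (h : epsUB κ l nc np ρ M ≤ ENNReal.ofReal ε) :
    Nonempty (Code κ l nc M ε ρ) := by
  obtain ⟨T, η, hT, hη, hmap, hint⟩ := exists_observation hκ hρ hnp l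
  have hn : 0 < nc - np := Nat.sub_pos_of_lt hnp
  obtain ⟨c, dec, hdec, herr⟩ := exists_shell_code hn hρ (varP_pos hκ np hρ)
    (measurable_muP κ np ρ) η l hM
  rw [hint] at herr
  have hTT : Measurable fun (y : Fin l → Fin nc → ℂ) k => T (y k) :=
    measurable_pi_lambda _ fun k => hT.comp (measurable_pi_apply k)
  have hlaw : ∀ j, (channelLaw κ fun k => pilotWord ρ (shellPoint ρ (c j k))).map
      (fun y k => T (y k)) = Measure.pi fun k =>
        (η.prod volume).withDensity (blockPDF ρ (varP κ np ρ) (muP κ np ρ) (c j k)) := by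
    intro j
    have hpr : ∀ k, IsProbabilityMeasure
        ((blockLaw κ (pilotWord ρ (shellPoint ρ (c j k)))).map T) := fun k =>
      Measure.isProbabilityMeasure_map hT.aemeasurable
    rw [channelLaw, Measure.pi_map_pi (hμ := fun k => by have := hpr k; infer_instance)
      fun k => hT.aemeasurable]
    simp only [hmap]
  have hset : ∀ j, MeasurableSet {y : Fin l → ℂ × (Fin (nc - np) → ℂ) | dec y ≠ j} := fun j =>
    (hdec (measurableSet_singleton j)).compl
  refine ⟨⟨fun j k => pilotWord ρ (shellPoint ρ (c j k)), fun y => dec fun k => T (y k),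
    hdec.comp hTT, fun j k => ?_, ?_⟩⟩
  · rw [normSq_pilotWord hnp hρ.le, normSq_shellPoint hρ.le, Nat.cast_sub hnp.le]
    ring
  · have hj : ∀ j, channelLaw κ (fun k => pilotWord ρ (shellPoint ρ (c j k)))
        {y | (dec fun k => T (y k)) ≠ j} = (Measure.pi fun k =>
        (η.prod volume).withDensity (blockPDF ρ (varP κ np ρ) (muP κ np ρ) (c j k)))
          {y | dec y ≠ j} := by
      intro j
      rw [← hlaw, Measure.map_apply hTT (hset j)]
      rfl
    have hsum : ∑ j, channelLaw κ (fun k => pilotWord ρ (shellPoint ρ (c j k)))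
        {y | (dec fun k => T (y k)) ≠ j} ≤ ENNReal.ofReal (M * ε) := by
      simp only [hj]
      rw [ENNReal.ofReal_mul (Nat.cast_nonneg M), ENNReal.ofReal_natCast]
      exact herr.trans (by gcongr)
    have hfin : ∀ j, channelLaw κ (fun k => pilotWord ρ (shellPoint ρ (c j k)))
        {y | (dec fun k => T (y k)) ≠ j} ≠ ⊤ := fun j =>
      ne_top_of_le_ne_top ENNReal.ofReal_ne_top
        ((Finset.single_le_sum (fun _ _ => zero_le) (Finset.mem_univ j)).trans hsum)
    have hreal := ENNReal.toReal_le_of_le_ofReal (by positivity) hsum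
    rw [ENNReal.toReal_sum fun j _ => hfin j] at hreal
    have hM' : (0 : ℝ) < M := by exact_mod_cast hM
    rw [one_div, inv_mul_le_iff₀ hM']
    exact hreal

end RicianPilot

end

theorem theorem3 (κ ρ ε : ℝ) (l nc np : ℕ) (hκ : 0 ≤ κ) (hρ : 0 < ρ) (hl : 0 < l) (hnp : np < nc)
    (hε₀ : 0 ≤ ε) (hε₁ : ε < 1) :
    ∃ r : ℝ,
      IsGreatest {r : ℝ | ∃ M : ℕ, 1 ≤ M ∧
        RicianPilot.epsUB κ l nc np ρ M ≤ ENNReal.ofReal ε ∧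
        r = Real.logb 2 M / ((nc : ℝ) * l)} r ∧
      (r : EReal) ≤ RicianPilot.maxRate κ l nc ε ρ := by
  have hlt : ENNReal.ofReal ε < ⨆ M, RicianPilot.epsUB κ l nc np ρ M := by
    rw [RicianPilot.iSup_epsUB hκ hρ hnp]
    simpa using hε₁
  -- Since the bound tends to 1 and `ε < 1`, some `N` violates the constraint; by monotonicity every
  -- larger size does too.
  obtain ⟨N, hN⟩ := lt_iSup_iff.1 hlt
  let A : Set ℕ := {M | 1 ≤ M ∧ RicianPilot.epsUB κ l nc np ρ M ≤ ENNReal.ofReal ε}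
  have hA : A.Nonempty := ⟨1, le_rfl, by simp [RicianPilot.epsUB_one]⟩
  have hbdd : BddAbove A := ⟨N, fun M hM => le_of_not_gt fun hNM =>
    absurd ((RicianPilot.epsUB_mono κ l nc np ρ hNM.le).trans hM.2) (not_le.2 hN)⟩
  obtain ⟨h1, h2⟩ := Nat.sSup_mem hA hbdd
  refine ⟨Real.logb 2 (sSup A : ℕ) / ((nc : ℝ) * l), ⟨⟨_, h1, h2, rfl⟩, ?_⟩, ?_⟩
  · rintro r ⟨M, hM1, hM2, rfl⟩
    have hM : (M : ℝ) ≤ (sSup A : ℕ) := by exact_mod_cast le_csSup hbdd ⟨hM1, hM2⟩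
    have h0 : (0 : ℝ) < M := by exact_mod_cast hM1
    gcongr
    exact one_lt_two
  · refine le_sSup ⟨_, RicianPilot.nonempty_code hκ hρ hnp hε₀ h1 h2, ?_⟩
    rw [mul_comm]
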